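/- Let $n\ge 0$, let $S_m$ be the symmetric group on $\{1,\dots,m\}$ with simple generators $s_i=(i,i+1)$ and Coxeter length $\ell$, and let $\circ$ denote the Demazure product on $S_m$, i.e. the unique associative operation such that, for $w \in S_m$ and each simple generator $s$, $s\circ w=sw$ if $\ell(sw)>\ell(w)$ and $s\circ w=w$ otherwise, and $w\circ s=ws$ if $\ell(ws)>\ell(w)$ and $w\circ s=w$ otherwise. Put $w_{\mathtt{FPF}}=s_1s_3s_5\cdots s_{2n-1}\in S_{2n}$. For a fixed-point-free involution $x\in S_{2n}$ let $\mathcal{A}_{\mathtt{FPF}}(x)$ be the set of elements of minimal length in $\{w\in S_{2n} : w^{-1}\circ w_{\mathtt{FPF}}\circ w=x\}$, and let $\mathcal{A}_{\mathtt{FPF}}(x)^{-1}=\{u\in S_{2n} : u^{-1}\in\mathcal{A}_{\mathtt{FPF}}(x)\}$. Let $\prec_{\mathcal{A}_{\mathtt{FPF}}}$ be the transitive closure of the relation on $2n$-element integer sequences given by $$[\alpha_1,\dots,\alpha_{2i},a,d,b,c,\beta_1,\dots,\beta_{2k}]\prec_{\mathcal{A}_{\mathtt{FPF}}}[\alpha_1,\dots,\alpha_{2i},b,c,a,d,\beta_1,\dots,\beta_{2k}]\qquad\text{whenever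 } a\le b\le c\le d,$$ for all even-length sequences $\alpha$, $\beta$; it is applied to permutations $u$ through their one-line notation $[u(1),\dots,u(2n)]$, and on $\mathcal{A}_{\mathtt{FPF}}(x)^{-1}$ it is a strict partial order. **Proposition.** Let $x$ be a fixed-point-free involution in $S_{2n}$. Then the poset $(\mathcal{A}_{\mathtt{FPF}}(x)^{-1},\prec_{\mathcal{A}_{\mathtt{FPF}}})$ is isomorphic to a lower interval $[1,w]=\{v\in S_n : 1\le_R v\le_R w\}$, for some $w\in S_n$, in the right weak order $\le_R$ on $S_n$ (the reflexive and transitive closure of the relation $v<_R vs$ for $v \in S_n$ and simple generators $s$ with $\ell(vs)>\ell(v)$). Consequently it is a graded lattice: any two elements have a least upper bound and a greatest lower bound, and there is a strictly increasing function $\operatorname{rank}:\mathcal{A}_{\mathtt{FPF}}(x)^{-1}\to\mathbb{N}$ such that $\operatorname{rank}(v)=\operatorname{rank}(u)+1$ whenever $v$ covers $u$. -/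

import Mathlib

namespace FPFAtoms

open Equiv

/-! ### The symmetric group `S_m = Perm (Fin m)` as a Coxeter group

The letters `1, …, m` are represented by `0, …, m - 1 : Fin m`. -/

/-- The simple generators of `S_m`: the adjacent transpositions `(i, i+1)`. -/
def simpleGens (m : ℕ) : Set (Perm (Fin m)) :=
  {s | ∃ i j : Fin m, (i : ℕ) + 1 = (j : ℕ) ∧ s = swap i j}

/-- `l` is an expression of `w` as a product of simple generators. -/
def IsWord {m : ℕ} (l : List (Perm (Fin m))) (w : Perm (Fin m)) : Prop :=
  (∀ s ∈ l, s ∈ simpleGens m) ∧ l.prod = w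

/-- The Coxeter length: the smallest length of an expression of `w`. -/
noncomputable def ell {m : ℕ} (w : Perm (Fin m)) : ℕ :=
  sInf {k | ∃ l : List (Perm (Fin m)), IsWord l w ∧ l.length = k}

/-- `l` is a reduced word of `w`. -/
def IsReducedWord {m : ℕ} (l : List (Perm (Fin m))) (w : Perm (Fin m)) : Prop :=
  IsWord l w ∧ l.length = ell w

theorem exists_isWord {m : ℕ} (w : Perm (Fin m)) : ∃ l, IsWord l w := by
  cases m with
  | zero => exact ⟨[], by simp, Subsingleton.elim _ _⟩
  | succ n =>
    have hw : w ∈ Submonoid.closure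
        (Set.range fun i : Fin n => swap i.castSucc i.succ) := by
      rw [Perm.mclosure_swap_castSucc_succ]; trivial
    obtain ⟨l, hl, hp⟩ := Submonoid.exists_list_of_mem_closure hw
    refine ⟨l, fun s hs => ?_, hp⟩
    obtain ⟨i, rfl⟩ := hl s hs
    exact ⟨i.castSucc, i.succ, by simp, rfl⟩

theorem exists_isReducedWord {m : ℕ} (w : Perm (Fin m)) : ∃ l, IsReducedWord l w := by
  obtain ⟨l, hl⟩ := exists_isWord w
  exact Nat.sInf_mem (s := {k | ∃ l, IsWord l w ∧ l.length = k}) ⟨_, l, hl, rfl⟩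

/-- A reduced word of `w`. -/
noncomputable def reducedWord {m : ℕ} (w : Perm (Fin m)) : List (Perm (Fin m)) :=
  Classical.choose (exists_isReducedWord w)

/-! ### Demazure product and atoms -/

open Classical in
/-- `w ∘ s` for a simple generator `s`: it is `ws` if `ℓ(w) < ℓ(ws)` and `w` otherwise. -/
noncomputable def demazureStep {m : ℕ} (w s : Perm (Fin m)) : Perm (Fin m) :=
  if ell w < ell (w * s) then w * s else w

/-- The Demazure product `u ∘ v`, that is `(⋯((u ∘ s₁) ∘ s₂) ∘ ⋯) ∘ s_k` for a reduced word
`(s₁, …, s_k)` of `v`. (As `∘` is associative and `v = s₁ ∘ ⋯ ∘ s_k`, the value does not depend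
on the reduced word.) -/
noncomputable def demazureMul {m : ℕ} (u v : Perm (Fin m)) : Perm (Fin m) :=
  (reducedWord v).foldl demazureStep u

/-- The operation `(x, w) ↦ w⁻¹ ∘ x ∘ w`. -/
noncomputable def demazureConj {m : ℕ} (x w : Perm (Fin m)) : Perm (Fin m) :=
  demazureMul (demazureMul w⁻¹ x) w

/-- The set `B(x, y)` of Hecke atoms of `y` relative to `x`. -/
def heckeAtoms {m : ℕ} (x y : Perm (Fin m)) : Set (Perm (Fin m)) :=
  {w | demazureConj x w = y}

/-- The set `A(x, y)` of atoms of `y` relative to `x`: the elements of minimal length in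
`B(x, y)`. -/
def atoms {m : ℕ} (x y : Perm (Fin m)) : Set (Perm (Fin m)) :=
  {w | w ∈ heckeAtoms x y ∧ ∀ v ∈ heckeAtoms x y, ell w ≤ ell v}

/-- The fixed-point-free involutions in `S_m`. -/
def fpfInvolutions (m : ℕ) : Set (Perm (Fin m)) :=
  {x | x⁻¹ = x ∧ ∀ i, x i ≠ i}

/-- The permutation `s₁ s₃ s₅ ⋯ s_{2n-1} = (1,2)(3,4)⋯(2n-1,2n)` of `S_{2n}`. -/
def wFPF (n : ℕ) : Perm (Fin (2 * n)) :=
  ((List.finRange n).map fun k : Fin n =>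
    swap (⟨2 * k, by omega⟩ : Fin (2 * n)) ⟨2 * k + 1, by omega⟩).prod

/-- The set `A_FPF(x) = A(w_FPF, x)`. -/
def fpfAtoms {n : ℕ} (x : Perm (Fin (2 * n))) : Set (Perm (Fin (2 * n))) :=
  atoms (wFPF n) x

/-! ### The order on integer sequences -/

/-- The generating relation
`[α₁,…,α₂ᵢ, a, d, b, c, β₁,…,β₂ₖ] ≺ [α₁,…,α₂ᵢ, b, c, a, d, β₁,…,β₂ₖ]` for `a ≤ b ≤ c ≤ d`. -/
inductive PrecStep : List ℤ → List ℤ → Prop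
  | mk (α β : List ℤ) (a b c d : ℤ) (hα : Even α.length) (hβ : Even β.length)
      (hab : a ≤ b) (hbc : b ≤ c) (hcd : c ≤ d) :
      PrecStep (α ++ [a, d, b, c] ++ β) (α ++ [b, c, a, d] ++ β)

/-- The relation `≺` on integer sequences: the transitive closure of `PrecStep`. -/
def Prec : List ℤ → List ℤ → Prop :=
  Relation.TransGen PrecStep

/-- The one-line notation `[u(1), u(2), …, u(m)]`, with letters in `{1, …, m}`. -/
def oneLine {m : ℕ} (u : Perm (Fin m)) : List ℤ :=
  List.ofFn fun i => ((u i : ℕ) : ℤ) + 1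

theorem oneLine_injective {m : ℕ} : Function.Injective (oneLine (m := m)) := by
  intro u v h
  have h' := List.ofFn_injective h
  ext i
  have := congrFun h' i
  simpa using this

theorem oneLine_nodup {m : ℕ} (u : Perm (Fin m)) : (oneLine u).Nodup := by
  rw [oneLine, List.nodup_ofFn]
  intro i j h
  apply u.injective
  ext
  simpa using h

theorem PrecStep.perm {l l' : List ℤ} (h : PrecStep l l') : l.Perm l' := by
  cases h with
  | mk α β a b c d =>
    refine (List.Perm.append_left α ?_).append_right β
    rw [List.perm_iff_count]
    intro x
    simp only [List.count_cons, List.count_nil]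
    omega

theorem PrecStep.lt {l l' : List ℤ} (h : PrecStep l l') (hl : l.Nodup) : l < l' := by
  cases h with
  | mk α β a b c d hα hβ hab hbc hcd =>
    have hne : a ≠ b := by
      rintro rfl
      simp [List.nodup_append] at hl
    have hlt : a < b := lt_of_le_of_ne hab hne
    rw [List.append_assoc, List.append_assoc]
    exact List.append_left_lt (List.Lex.rel hlt)

theorem Prec.lt {l l' : List ℤ} (h : Prec l l') (hl : l.Nodup) : l < l' := by
  have : l.Perm l' ∧ l < l' := by
    induction h with
    | single h => exact ⟨h.perm, h.lt hl⟩
    | tail _ h ih => exact ⟨ih.1.trans h.perm, ih.2.trans (h.lt (ih.1.nodup_iff.1 hl))⟩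
  exact this.2

/-- The set `A_FPF(x)⁻¹ = {u ∈ S_{2n} : u⁻¹ ∈ A_FPF(x)}`. -/
def FPFAtomsInv {n : ℕ} (x : Perm (Fin (2 * n))) : Type :=
  {u : Perm (Fin (2 * n)) // u⁻¹ ∈ fpfAtoms x}

/-- The poset `(A_FPF(x)⁻¹, ≺)`: `u < v` means `u ≺ v` as sequences in one-line notation. -/
instance {n : ℕ} (x : Perm (Fin (2 * n))) : PartialOrder (FPFAtomsInv x) where
  le u v := u = v ∨ Prec (oneLine u.1) (oneLine v.1)
  lt u v := Prec (oneLine u.1) (oneLine v.1)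
  le_refl u := Or.inl rfl
  le_trans u v w huv hvw := by
    rcases huv with rfl | huv
    · exact hvw
    · rcases hvw with rfl | hvw
      · exact Or.inr huv
      · exact Or.inr (Relation.TransGen.trans huv hvw)
  lt_iff_le_not_ge u v := by
    constructor
    · intro h
      refine ⟨Or.inr h, ?_⟩
      have h1 := h.lt (oneLine_nodup _)
      rintro (rfl | h')
      · exact lt_irrefl _ h1
      · exact lt_asymm h1 (h'.lt (oneLine_nodup _))
    · rintro ⟨rfl | h, h'⟩
      · exact absurd (Or.inl rfl) h'
      · exact h
  le_antisymm u v huv hvu := by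
    rcases huv with rfl | huv
    · rfl
    · rcases hvu with rfl | hvu
      · rfl
      · exact absurd (hvu.lt (oneLine_nodup _)) (lt_asymm (huv.lt (oneLine_nodup _)))

/-! ### The right weak order -/

/-- The symmetric group `S_m`, to be ordered by the right weak order. -/
def RightWeak (m : ℕ) : Type := Perm (Fin m)

/-- The identity permutation. -/
def RightWeak.id (m : ℕ) : RightWeak m := (1 : Perm (Fin m))

/-- The generating relation `w <_R wt` of the right weak order, for simple generators `t` with
`ℓ(w) < ℓ(wt)`. -/
def WeakStep {m : ℕ} (u v : Perm (Fin m)) : Prop :=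
  ∃ t ∈ simpleGens m, v = u * t ∧ ell u < ell (u * t)

theorem ell_le_of_weak {m : ℕ} {u v : Perm (Fin m)}
    (h : Relation.ReflTransGen WeakStep u v) : u = v ∨ ell u < ell v := by
  induction h with
  | refl => exact Or.inl rfl
  | tail _ h ih =>
    obtain ⟨t, _, rfl, hlt⟩ := h
    rcases ih with rfl | ih
    · exact Or.inr hlt
    · exact Or.inr (ih.trans hlt)

/-- The right weak order `≤_R` on `S_m`. -/
instance (m : ℕ) : PartialOrder (RightWeak m) where
  le u v := Relation.ReflTransGen (WeakStep (m := m)) u v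
  le_refl _ := Relation.ReflTransGen.refl
  le_trans _ _ _ := Relation.ReflTransGen.trans
  le_antisymm u v huv hvu := by
    rcases ell_le_of_weak huv with h | h
    · exact h
    · rcases ell_le_of_weak hvu with h' | h'
      · exact h'.symm
      · exact absurd h (lt_asymm h')

end FPFAtoms

/-! Conjugating a fixed-point-free involution by a simple generator raises the length by at most 2,
and the Demazure conjugation either performs such a raise by exactly 2 or does nothing. So once one
element takes `wFPF n` to `x` by ordinary conjugation with the maximal gain of twice its length, the
atoms of `x` are precisely the elements doing so (`mem_atoms_iff`).

For `u` with `u * wFPF n * u⁻¹ = x`, the word of `u` lists the cycles of `x` in consecutive blocks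
of two letters. Comparing inversions block by block shows that the length of `x` is at most `n` plus
twice the length of `u`. Equality holds exactly when every block is increasing and any two blocks
with decreasing first letters are nested, the inner one standing first (`invCount_conj_eq_iff`).

Let `u₀` list the cycles `(aᵢ, bᵢ)`, `aᵢ < bᵢ`, by increasing `aᵢ`. The inverse atoms are then the
words `u₀ * blockPerm v` such that `b_j < b_i` for every inversion `i < j` of `v`. The pairs `i < j`
with `b_j < b_i` themselves form the inversion set of a permutation `w`. As right weak order is
containment of inversion sets, the condition says `v ≤_R w`. A generating move of `≺` exchanges two
adjacent nested blocks, which is one step up in weak order below `w` (`eq_or_prec_iff_weak`).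

The lattice property comes from the description of inversion sets as the transitive and cotransitive
relations contained in `<`: joins are transitive closures of unions, and meets follow by
complementation. The grading is by length. -/

namespace FPFAtoms

open Equiv

/-! ### Coxeter length as the number of inversions -/

/-- The number of inversions of a permutation. -/
def invCount {m : ℕ} (w : Perm (Fin m)) : ℕ :=
  ∑ k : Fin m, ∑ l : Fin m, if k < l ∧ w l < w k then 1 else 0

theorem sum_sum_comp_perm {m : ℕ} (σ : Perm (Fin m)) (f : Fin m → Fin m → ℕ) :
    ∑ k, ∑ l, f (σ k) (σ l) = ∑ k, ∑ l, f k l := by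
  rw [← Equiv.sum_comp σ fun k => ∑ l, f k l]
  exact Finset.sum_congr rfl fun k _ => Equiv.sum_comp σ (f (σ k))

theorem invCount_one (m : ℕ) : invCount (1 : Perm (Fin m)) = 0 := by
  refine Finset.sum_eq_zero fun k _ => Finset.sum_eq_zero fun l _ => ?_
  rw [if_neg]
  simp only [Perm.coe_one, id_eq, not_and, not_lt]
  exact le_of_lt

theorem invCount_inv {m : ℕ} (w : Perm (Fin m)) : invCount w⁻¹ = invCount w := by
  unfold invCount
  rw [← sum_sum_comp_perm w, Finset.sum_comm]
  simp [and_comm]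

/-- No letter lies strictly between `i` and `j`, so exchanging them affects only their comparison
with each other. -/
theorem swap_lt_swap_iff {m : ℕ} {i j : Fin m} (hij : (i : ℕ) + 1 = j) {k l : Fin m}
    (h₁ : ¬(k = i ∧ l = j)) (h₂ : ¬(k = j ∧ l = i)) :
    swap i j k < swap i j l ↔ k < l := by
  simp only [swap_apply_def]
  simp only [Fin.ext_iff, Fin.lt_def] at *
  split_ifs <;> omega

theorem swap_mem_simpleGens {m : ℕ} {i j : Fin m} (hij : (i : ℕ) + 1 = j) :
    swap i j ∈ simpleGens m := ⟨i, j, hij, rfl⟩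

theorem invCount_mul_swap_of_lt {m : ℕ} {i j : Fin m} (hij : (i : ℕ) + 1 = j)
    {w : Perm (Fin m)} (h : w i < w j) : invCount (w * swap i j) = invCount w + 1 := by
  have hij' : i < j := by rw [Fin.lt_def]; omega
  unfold invCount
  rw [← sum_sum_comp_perm (swap i j)]
  -- The extra inversion is written as a double sum supported at `(j, i)`, so that after reindexing
  -- the identity can be checked term by term.
  have hone : ∑ k : Fin m, ∑ l : Fin m, (if k = j ∧ l = i then 1 else 0) = 1 := by
    simp [ite_and]
  refine Eq.trans ?_ (congrArg (_ + ·) hone)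
  rw [← Finset.sum_add_distrib]
  refine Finset.sum_congr rfl fun k _ => ?_
  rw [← Finset.sum_add_distrib]
  refine Finset.sum_congr rfl fun l _ => ?_
  simp only [Perm.mul_apply, swap_apply_self]
  by_cases h₁ : k = i ∧ l = j
  · obtain ⟨rfl, rfl⟩ := h₁
    simp [h.not_gt, hij'.ne]
  by_cases h₂ : k = j ∧ l = i
  · obtain ⟨rfl, rfl⟩ := h₂
    simp [h, hij', hij'.not_gt]
  simp only [swap_lt_swap_iff hij h₁ h₂, if_neg h₂, add_zero]

theorem invCount_mul_swap_of_gt {m : ℕ} {i j : Fin m} (hij : (i : ℕ) + 1 = j)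
    {w : Perm (Fin m)} (h : w j < w i) : invCount (w * swap i j) + 1 = invCount w := by
  rw [← invCount_mul_swap_of_lt hij (by simpa using h), mul_assoc, swap_mul_self, mul_one]

theorem apply_lt_or_gt {m : ℕ} {i j : Fin m} (hij : (i : ℕ) + 1 = j) (w : Perm (Fin m)) :
    w i < w j ∨ w j < w i := by
  refine lt_or_gt_of_ne fun h => ?_
  have := congrArg Fin.val (w.injective h)
  omega

theorem invCount_mul_le {m : ℕ} {s : Perm (Fin m)} (hs : s ∈ simpleGens m)
    (w : Perm (Fin m)) : invCount (w * s) ≤ invCount w + 1 := by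
  obtain ⟨i, j, hij, rfl⟩ := hs
  rcases apply_lt_or_gt hij w with h | h
  · exact (invCount_mul_swap_of_lt hij h).le
  · have := invCount_mul_swap_of_gt hij h
    omega

theorem invCount_mul_prod_le {m : ℕ} (l : List (Perm (Fin m))) (hl : ∀ s ∈ l, s ∈ simpleGens m)
    (w : Perm (Fin m)) : invCount (w * l.prod) ≤ invCount w + l.length := by
  induction l generalizing w with
  | nil => simp
  | cons s l ih =>
    have h₁ := ih (fun t ht => hl t (List.mem_cons_of_mem _ ht)) (w * s)
    have h₂ := invCount_mul_le (hl s List.mem_cons_self) w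
    rw [List.prod_cons, ← mul_assoc, List.length_cons]
    omega

/-- A function on `Fin m` that increases at each step is strictly increasing. -/
theorem strictMono_of_adjacent {m : ℕ} {α : Type*} [Preorder α] {f : Fin m → α}
    (h : ∀ i j : Fin m, (i : ℕ) + 1 = j → f i < f j) : StrictMono f := by
  cases m with
  | zero => exact fun i => i.elim0
  | succ m => exact Fin.strictMono_iff_lt_succ.2 fun i => h _ _ (by simp)

theorem perm_eq_one_of_strictMono {m : ℕ} {w : Perm (Fin m)} (h : StrictMono w) : w = 1 := by
  have : h.orderIsoOfSurjective w w.surjective = OrderIso.refl _ := Subsingleton.elim _ _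
  ext i
  simpa using congrArg (fun e : Fin m ≃o Fin m => ((e i : Fin m) : ℕ)) this

theorem exists_isWord_length_eq_invCount {m : ℕ} (w : Perm (Fin m)) :
    ∃ l, IsWord l w ∧ l.length = invCount w := by
  induction hk : invCount w generalizing w with
  | zero =>
    refine ⟨[], ⟨by simp, ?_⟩, rfl⟩
    refine (perm_eq_one_of_strictMono (strictMono_of_adjacent fun i j hij => ?_)).symm
    rcases apply_lt_or_gt hij w with h | h
    · exact h
    · have := invCount_mul_swap_of_gt hij h
      omega
  | succ k ih =>
    have : ∃ i j : Fin m, (i : ℕ) + 1 = j ∧ w j < w i := by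
      by_contra! hcon
      have : w = 1 := perm_eq_one_of_strictMono <| strictMono_of_adjacent fun i j hij =>
        (apply_lt_or_gt hij w).resolve_right (hcon i j hij).not_gt
      rw [this, invCount_one] at hk
      omega
    obtain ⟨i, j, hij, h⟩ := this
    have h' := invCount_mul_swap_of_gt hij h
    obtain ⟨l, ⟨hl, hp⟩, hlen⟩ := ih (w * swap i j) (by omega)
    refine ⟨l ++ [swap i j], ⟨fun s hs => ?_, ?_⟩, by simp [hlen]⟩
    · rcases List.mem_append.1 hs with hs | hs
      · exact hl s hs
      · rw [List.mem_singleton.1 hs]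
        exact ⟨i, j, hij, rfl⟩
    · rw [List.prod_append, hp, List.prod_singleton, mul_assoc, swap_mul_self, mul_one]

theorem ell_eq_invCount {m : ℕ} (w : Perm (Fin m)) : ell w = invCount w := by
  apply le_antisymm
  · exact Nat.sInf_le (exists_isWord_length_eq_invCount w)
  · obtain ⟨l, ⟨hl, hp⟩, hlen⟩ := exists_isReducedWord w
    rw [← hlen, ← hp]
    simpa [invCount_one] using invCount_mul_prod_le l hl 1

theorem ell_lt_ell_mul_swap_iff {m : ℕ} {i j : Fin m} (hij : (i : ℕ) + 1 = j)
    {w : Perm (Fin m)} : ell w < ell (w * swap i j) ↔ w i < w j := by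
  rw [ell_eq_invCount, ell_eq_invCount]
  rcases apply_lt_or_gt hij w with h | h
  · simp [h, invCount_mul_swap_of_lt hij h]
  · have := invCount_mul_swap_of_gt hij h
    simp only [h.not_gt, iff_false]
    omega

/-! ### Demazure conjugation and atoms -/

theorem demazureStep_swap {m : ℕ} {i j : Fin m} (hij : (i : ℕ) + 1 = j) (w : Perm (Fin m)) :
    demazureStep w (swap i j) = if w i < w j then w * swap i j else w := by
  unfold demazureStep
  simp only [ell_lt_ell_mul_swap_iff hij]

/-- The left action `s ∘ w` of a simple generator. -/
noncomputable def demazureLeft {m : ℕ} (w s : Perm (Fin m)) : Perm (Fin m) :=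
  (demazureStep w⁻¹ s)⁻¹

theorem demazureLeft_swap {m : ℕ} {i j : Fin m} (hij : (i : ℕ) + 1 = j) (w : Perm (Fin m)) :
    demazureLeft w (swap i j) = if w⁻¹ i < w⁻¹ j then swap i j * w else w := by
  unfold demazureLeft
  rw [demazureStep_swap hij]
  split_ifs <;> simp

/-- The left and right actions can interfere only when `w` carries the pair exchanged by `t` onto
the pair exchanged by `s`. Then `s * w = w * t`, and both orders give the longer of `w` and `w * t`.
Otherwise neither action affects the comparison that decides the other. -/
theorem demazureLeft_demazureStep_comm {m : ℕ} {s t : Perm (Fin m)} (hs : s ∈ simpleGens m)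
    (ht : t ∈ simpleGens m) (w : Perm (Fin m)) :
    demazureLeft (demazureStep w t) s = demazureStep (demazureLeft w s) t := by
  obtain ⟨i, j, hij, rfl⟩ := hs
  obtain ⟨k, l, hkl, rfl⟩ := ht
  simp only [demazureLeft_swap hij, demazureStep_swap hkl]
  have hij' : i < j := by rw [Fin.lt_def]; omega
  have hkl' : k < l := by rw [Fin.lt_def]; omega
  by_cases h₁ : w k = i ∧ w l = j
  · obtain ⟨rfl, rfl⟩ := h₁
    simp [hij', hkl', hij'.not_gt, hkl'.not_gt, mul_swap_eq_swap_mul]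
  by_cases h₂ : w k = j ∧ w l = i
  · obtain ⟨rfl, rfl⟩ := h₂
    simp [hij'.not_gt, hkl'.not_gt]
  have e₁ : swap i j (w k) < swap i j (w l) ↔ w k < w l := swap_lt_swap_iff hij h₁ h₂
  have e₂ : swap k l (w⁻¹ i) < swap k l (w⁻¹ j) ↔ w⁻¹ i < w⁻¹ j := by
    refine swap_lt_swap_iff hkl (fun h => h₁ ?_) (fun h => h₂ ?_)
    · rw [← h.1, ← h.2]; simp
    · rw [← h.1, ← h.2]; simp
  by_cases h₃ : w k < w l <;> by_cases h₄ : w⁻¹ i < w⁻¹ j <;>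
    simp only [h₃, h₄, e₁, e₂, if_true, if_false, mul_inv_rev, swap_inv, Perm.mul_apply, mul_assoc]

/-- Each letter adds at most one to the length, so a total gain equal to the number of letters
forces every step to go up. -/
theorem foldl_demazureStep_of_reduced {m : ℕ} (l : List (Perm (Fin m)))
    (hl : ∀ s ∈ l, s ∈ simpleGens m) (w : Perm (Fin m))
    (h : invCount (w * l.prod) = invCount w + l.length) :
    l.foldl demazureStep w = w * l.prod := by
  induction l generalizing w with
  | nil => simp
  | cons s l ih =>
    have hl' := fun t ht => hl t (List.mem_cons_of_mem _ ht)
    have hs := hl s List.mem_cons_self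
    have h₁ := invCount_mul_prod_le l hl' (w * s)
    have h₂ := invCount_mul_le hs w
    rw [List.prod_cons, ← mul_assoc] at h ⊢
    rw [List.length_cons] at h
    have h₃ : demazureStep w s = w * s := by
      unfold demazureStep
      rw [if_pos]
      rw [ell_eq_invCount, ell_eq_invCount]
      omega
    rw [List.foldl_cons, h₃]
    exact ih hl' _ (by omega)

theorem foldl_demazureStep_one {m : ℕ} {l : List (Perm (Fin m))} {w : Perm (Fin m)}
    (h : IsReducedWord l w) : l.foldl demazureStep 1 = w := by
  obtain ⟨⟨hl, hp⟩, hlen⟩ := h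
  rw [foldl_demazureStep_of_reduced l hl, one_mul, hp]
  rw [one_mul, hp, invCount_one, hlen, ell_eq_invCount, zero_add]

theorem foldl_demazureLeft_eq {m : ℕ} (l : List (Perm (Fin m))) (w : Perm (Fin m)) :
    l.foldl demazureLeft w = (l.foldl demazureStep w⁻¹)⁻¹ := by
  induction l generalizing w with
  | nil => simp
  | cons s l ih => rw [List.foldl_cons, ih, List.foldl_cons, demazureLeft, _root_.inv_inv]

theorem foldl_demazureLeft_demazureStep_comm {m : ℕ} {l : List (Perm (Fin m))}
    (hl : ∀ s ∈ l, s ∈ simpleGens m) {t : Perm (Fin m)} (ht : t ∈ simpleGens m)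
    (w : Perm (Fin m)) :
    l.foldl demazureLeft (demazureStep w t) = demazureStep (l.foldl demazureLeft w) t := by
  induction l generalizing w with
  | nil => rfl
  | cons s l ih =>
    rw [List.foldl_cons, demazureLeft_demazureStep_comm (hl s List.mem_cons_self) ht,
      ih fun t ht => hl t (List.mem_cons_of_mem _ ht), List.foldl_cons]

theorem foldl_demazureLeft_foldl_demazureStep_comm {m : ℕ} {l r : List (Perm (Fin m))}
    (hl : ∀ s ∈ l, s ∈ simpleGens m) (hr : ∀ s ∈ r, s ∈ simpleGens m) (w : Perm (Fin m)) :
    r.foldl demazureStep (l.foldl demazureLeft w) =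
      l.foldl demazureLeft (r.foldl demazureStep w) := by
  induction r generalizing w with
  | nil => rfl
  | cons s r ih =>
    rw [List.foldl_cons, ← foldl_demazureLeft_demazureStep_comm hl (hr s List.mem_cons_self),
      ih fun t ht => hr t (List.mem_cons_of_mem _ ht), List.foldl_cons]

/-- The operation `(y, s) ↦ s ∘ y ∘ s` for a simple generator `s`. -/
noncomputable def demazureConjStep {m : ℕ} (y s : Perm (Fin m)) : Perm (Fin m) :=
  demazureStep (demazureLeft y s) s

theorem foldl_demazureStep_foldl_demazureLeft {m : ℕ} {l : List (Perm (Fin m))}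
    (hl : ∀ s ∈ l, s ∈ simpleGens m) (y : Perm (Fin m)) :
    l.foldl demazureStep (l.foldl demazureLeft y) = l.foldl demazureConjStep y := by
  induction l generalizing y with
  | nil => rfl
  | cons s l ih =>
    have hl' := fun t ht => hl t (List.mem_cons_of_mem _ ht)
    rw [List.foldl_cons, List.foldl_cons, List.foldl_cons,
      ← foldl_demazureLeft_demazureStep_comm hl' (hl s List.mem_cons_self), ih hl']
    rfl

theorem reducedWord_spec {m : ℕ} (w : Perm (Fin m)) : IsReducedWord (reducedWord w) w :=
  Classical.choose_spec (exists_isReducedWord w)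

/-- Since left and right actions commute, `w⁻¹ ∘ y ∘ w` can be built from `y` by applying `s ∘ · ∘
s` for the successive letters `s` of a reduced word of `w`. -/
theorem demazureConj_eq_foldl {m : ℕ} (y w : Perm (Fin m)) :
    demazureConj y w = (reducedWord w).foldl demazureConjStep y := by
  have hw := reducedWord_spec w
  have hy := reducedWord_spec y
  have h : w⁻¹ = (reducedWord w).foldl demazureLeft 1 := by
    rw [foldl_demazureLeft_eq, inv_one, foldl_demazureStep_one hw]
  unfold demazureConj demazureMul
  rw [h, foldl_demazureLeft_foldl_demazureStep_comm hw.1.1 hy.1.1, foldl_demazureStep_one hy,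
    foldl_demazureStep_foldl_demazureLeft hw.1.1]

/-- Absence of fixed points excludes the case in which `s` commutes with `y` and `y * s` is longer
than `y`. Hence if the left action goes up, so does the right one. -/
theorem demazureConjStep_swap {m : ℕ} {i j : Fin m} (hij : (i : ℕ) + 1 = j)
    {y : Perm (Fin m)} (hy : y ∈ fpfInvolutions m) :
    demazureConjStep y (swap i j) = if y i < y j then swap i j * y * swap i j else y := by
  unfold demazureConjStep
  rw [demazureLeft_swap hij, hy.1]
  split_ifs with h
  · rw [demazureStep_swap hij, if_pos]
    refine (swap_lt_swap_iff hij (fun h' => hy.2 i h'.1) fun h' => ?_).2 h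
    rw [h'.1, h'.2, Fin.lt_def] at h
    omega
  · rw [demazureStep_swap hij, if_neg h]

theorem conj_mem_fpfInvolutions {m : ℕ} {y : Perm (Fin m)} (hy : y ∈ fpfInvolutions m)
    (w : Perm (Fin m)) : w⁻¹ * y * w ∈ fpfInvolutions m := by
  refine ⟨by simp [mul_assoc, hy.1], fun i h => hy.2 (w i) ?_⟩
  exact Perm.inv_eq_iff_eq.1 h

theorem invCount_conj_swap_of_lt {m : ℕ} {i j : Fin m} (hij : (i : ℕ) + 1 = j)
    {y : Perm (Fin m)} (hy : y ∈ fpfInvolutions m) (h : y i < y j) :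
    invCount (swap i j * y * swap i j) = invCount y + 2 := by
  have h₁ : swap i j (y i) < swap i j (y j) := by
    refine (swap_lt_swap_iff hij (fun h' => hy.2 i h'.1) fun h' => ?_).2 h
    rw [h'.1, h'.2, Fin.lt_def] at h
    omega
  rw [invCount_mul_swap_of_lt hij h₁, ← invCount_inv (swap i j * y), mul_inv_rev, hy.1,
    swap_inv, invCount_mul_swap_of_lt hij h]

theorem invCount_conj_swap_of_gt {m : ℕ} {i j : Fin m} (hij : (i : ℕ) + 1 = j)
    {y : Perm (Fin m)} (hy : y ∈ fpfInvolutions m) (h : y j < y i) :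
    invCount (swap i j * y * swap i j) ≤ invCount y := by
  have h₁ := invCount_mul_le (swap_mem_simpleGens hij) (swap i j * y)
  have h₂ := invCount_mul_swap_of_gt hij h
  rw [← invCount_inv (swap i j * y), mul_inv_rev, hy.1, swap_inv] at h₁
  omega

/-- Demazure and ordinary conjugation both gain at most 2 per letter, and they differ only at a
letter where neither gains anything. If either attains the maximal total, no such letter occurs and
the two results agree. -/
theorem foldl_demazureConjStep_bound {m : ℕ} {l : List (Perm (Fin m))}
    (hl : ∀ s ∈ l, s ∈ simpleGens m) {y : Perm (Fin m)} (hy : y ∈ fpfInvolutions m) :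
    invCount (l.foldl demazureConjStep y) ≤ invCount y + 2 * l.length ∧
    invCount (l.prod⁻¹ * y * l.prod) ≤ invCount y + 2 * l.length ∧
    (invCount (l.foldl demazureConjStep y) = invCount y + 2 * l.length →
      l.foldl demazureConjStep y = l.prod⁻¹ * y * l.prod) ∧
    (invCount (l.prod⁻¹ * y * l.prod) = invCount y + 2 * l.length →
      l.foldl demazureConjStep y = l.prod⁻¹ * y * l.prod) := by
  induction l generalizing y with
  | nil => simp
  | cons s l ih =>
    have hl' := fun t ht => hl t (List.mem_cons_of_mem _ ht)
    obtain ⟨i, j, hij, rfl⟩ := hl s List.mem_cons_self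
    have hy' : swap i j * y * swap i j ∈ fpfInvolutions m := by
      simpa using conj_mem_fpfInvolutions hy (swap i j)
    have e : (swap i j :: l).prod⁻¹ * y * (swap i j :: l).prod =
        l.prod⁻¹ * (swap i j * y * swap i j) * l.prod := by
      simp [mul_assoc]
    rw [List.foldl_cons, e, demazureConjStep_swap hij hy, List.length_cons]
    obtain ⟨a₁, a₂, a₃, a₄⟩ := ih hl' hy'
    rcases apply_lt_or_gt hij y with h | h
    · have := invCount_conj_swap_of_lt hij hy h
      rw [if_pos h]
      exact ⟨by omega, by omega, fun h => a₃ (by omega), fun h => a₄ (by omega)⟩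
    · have := invCount_conj_swap_of_gt hij hy h
      obtain ⟨b₁, -⟩ := ih hl' hy
      rw [if_neg h.not_gt]
      exact ⟨by omega, by omega, fun h => by omega, fun h => by omega⟩

/-- If some `v` conjugates `y` to `x` with length increase `2ℓ(v)`, then the atoms of `x`
relative to `y` are exactly the elements of this kind. -/
theorem mem_atoms_iff {m : ℕ} {x y v : Perm (Fin m)} (hy : y ∈ fpfInvolutions m)
    (hv : v⁻¹ * y * v = x) (hlen : invCount x = invCount y + 2 * invCount v)
    (w : Perm (Fin m)) :
    w ∈ atoms y x ↔ w⁻¹ * y * w = x ∧ invCount x = invCount y + 2 * invCount w := by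
  have key : ∀ w : Perm (Fin m), w⁻¹ * y * w = x →
      invCount x = invCount y + 2 * invCount w → w ∈ heckeAtoms y x := by
    intro w hw hlw
    obtain ⟨⟨hl, hp⟩, hlen⟩ := reducedWord_spec w
    obtain ⟨-, -, -, h⟩ := foldl_demazureConjStep_bound hl hy
    rw [hp, hw, hlen, ell_eq_invCount] at h
    rw [heckeAtoms, Set.mem_ofPred_eq, demazureConj_eq_foldl]
    exact h hlw
  have bound : ∀ w ∈ heckeAtoms y x, invCount x ≤ invCount y + 2 * invCount w ∧
      (invCount x = invCount y + 2 * invCount w → w⁻¹ * y * w = x) := by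
    intro w hw
    rw [heckeAtoms, Set.mem_ofPred_eq, demazureConj_eq_foldl] at hw
    obtain ⟨⟨hl, hp⟩, hlen⟩ := reducedWord_spec w
    obtain ⟨h₁, -, h₂, -⟩ := foldl_demazureConjStep_bound hl hy
    rw [hp, hw, hlen, ell_eq_invCount] at h₂
    rw [hw, hlen, ell_eq_invCount] at h₁
    exact ⟨h₁, fun h => (h₂ h).symm⟩
  constructor
  · rintro ⟨hw, hmin⟩
    have h₁ := hmin v (key v hv hlen)
    rw [ell_eq_invCount, ell_eq_invCount] at h₁
    obtain ⟨h₂, h₃⟩ := bound w hw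
    have h₄ : invCount x = invCount y + 2 * invCount w := by omega
    exact ⟨h₃ h₄, h₄⟩
  · rintro ⟨hw, hlw⟩
    refine ⟨key w hw hlw, fun u hu => ?_⟩
    have := (bound u hu).1
    rw [ell_eq_invCount, ell_eq_invCount]
    omega

/-! ### Blocks of two letters and the length of a conjugate of `wFPF` -/

/-- The first position of the `p`-th block. -/
def evenPos {n : ℕ} (p : Fin n) : Fin (2 * n) := ⟨2 * p, by omega⟩

/-- The second position of the `p`-th block. -/
def oddPos {n : ℕ} (p : Fin n) : Fin (2 * n) := ⟨2 * p + 1, by omega⟩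

theorem evenPos_lt_evenPos {n : ℕ} {p q : Fin n} : evenPos p < evenPos q ↔ p < q := by
  simp only [evenPos, Fin.lt_def]; omega

theorem evenPos_lt_oddPos {n : ℕ} {p q : Fin n} : evenPos p < oddPos q ↔ p ≤ q := by
  simp only [evenPos, oddPos, Fin.lt_def, Fin.le_def]; omega

theorem oddPos_lt_evenPos {n : ℕ} {p q : Fin n} : oddPos p < evenPos q ↔ p < q := by
  simp only [evenPos, oddPos, Fin.lt_def]; omega

theorem oddPos_lt_oddPos {n : ℕ} {p q : Fin n} : oddPos p < oddPos q ↔ p < q := by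
  simp only [oddPos, Fin.lt_def]; omega

theorem evenPos_injective {n : ℕ} : Function.Injective (evenPos (n := n)) := by
  intro p q h
  simp only [evenPos, Fin.ext_iff] at *; omega

theorem oddPos_injective {n : ℕ} : Function.Injective (oddPos (n := n)) := by
  intro p q h
  simp only [oddPos, Fin.ext_iff] at *; omega

theorem evenPos_ne_oddPos {n : ℕ} (p q : Fin n) : evenPos p ≠ oddPos q := by
  intro h
  simp only [evenPos, oddPos, Fin.ext_iff] at h; omega

theorem exists_evenPos_or_oddPos {n : ℕ} (k : Fin (2 * n)) :
    ∃ p : Fin n, k = evenPos p ∨ k = oddPos p := by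
  refine ⟨⟨k / 2, by omega⟩, ?_⟩
  simp only [evenPos, oddPos, Fin.ext_iff]; omega

theorem bijective_elim_evenPos_oddPos {n : ℕ} :
    Function.Bijective (Sum.elim (evenPos (n := n)) oddPos) := by
  refine ⟨evenPos_injective.sumElim oddPos_injective evenPos_ne_oddPos, fun k => ?_⟩
  obtain ⟨p, rfl | rfl⟩ := exists_evenPos_or_oddPos k
  · exact ⟨Sum.inl p, rfl⟩
  · exact ⟨Sum.inr p, rfl⟩

theorem sum_blocks {n : ℕ} (f : Fin (2 * n) → ℕ) :
    ∑ k, f k = ∑ p, (f (evenPos p) + f (oddPos p)) := by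
  rw [← (Equiv.ofBijective _ bijective_elim_evenPos_oddPos).sum_comp, Fintype.sum_sum_type,
    Finset.sum_add_distrib]
  rfl

theorem prod_block_swaps_apply {n : ℕ} (L : List (Fin n)) (hL : L.Nodup) (p : Fin n) :
    (L.map fun k => swap (evenPos k) (oddPos k)).prod (evenPos p) =
      (if p ∈ L then oddPos p else evenPos p) ∧
    (L.map fun k => swap (evenPos k) (oddPos k)).prod (oddPos p) =
      (if p ∈ L then evenPos p else oddPos p) := by
  induction L with
  | nil => simp
  | cons k L ih =>
    rw [List.nodup_cons] at hL
    obtain ⟨h₁, h₂⟩ := ih hL.2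
    rw [List.map_cons, List.prod_cons, Perm.mul_apply, Perm.mul_apply, h₁, h₂]
    by_cases hk : p = k
    · subst hk
      simp [hL.1]
    · have e₁ : evenPos p ≠ evenPos k := fun h => hk (evenPos_injective h)
      have e₂ : oddPos p ≠ oddPos k := fun h => hk (oddPos_injective h)
      have e₃ := evenPos_ne_oddPos p k
      have e₄ := (evenPos_ne_oddPos k p).symm
      by_cases hp : p ∈ L <;> simp [hp, hk, swap_apply_of_ne_of_ne, e₁, e₂, e₃, e₄]

theorem wFPF_evenPos {n : ℕ} (p : Fin n) : wFPF n (evenPos p) = oddPos p :=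
  (prod_block_swaps_apply (List.finRange n) (List.nodup_finRange n) p).1.trans
    (if_pos (List.mem_finRange p))

theorem wFPF_oddPos {n : ℕ} (p : Fin n) : wFPF n (oddPos p) = evenPos p :=
  (prod_block_swaps_apply (List.finRange n) (List.nodup_finRange n) p).2.trans
    (if_pos (List.mem_finRange p))

theorem wFPF_mem_fpfInvolutions (n : ℕ) : wFPF n ∈ fpfInvolutions (2 * n) := by
  refine ⟨?_, fun k => ?_⟩
  · rw [inv_eq_iff_mul_eq_one]
    ext k
    obtain ⟨p, rfl | rfl⟩ := exists_evenPos_or_oddPos k <;>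
      simp [wFPF_evenPos, wFPF_oddPos]
  · obtain ⟨p, rfl | rfl⟩ := exists_evenPos_or_oddPos k
    · rw [wFPF_evenPos]; exact (evenPos_ne_oddPos p p).symm
    · rw [wFPF_oddPos]; exact evenPos_ne_oddPos p p

/-- The inversions of the word `u` with first letter in block `p` and second in block `q`. -/
def wordBlock {n : ℕ} (u : Perm (Fin (2 * n))) (p q : Fin n) : ℕ :=
  (if evenPos p < evenPos q ∧ u (evenPos q) < u (evenPos p) then 1 else 0) +
  (if evenPos p < oddPos q ∧ u (oddPos q) < u (evenPos p) then 1 else 0) +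
  ((if oddPos p < evenPos q ∧ u (evenPos q) < u (oddPos p) then 1 else 0) +
  (if oddPos p < oddPos q ∧ u (oddPos q) < u (oddPos p) then 1 else 0))

/-- The inversions of `u * wFPF * u⁻¹` with first letter among the values of `u` on block `p`
and second letter among the values of `u` on block `q`. -/
def cycleBlock {n : ℕ} (u : Perm (Fin (2 * n))) (p q : Fin n) : ℕ :=
  (if u (evenPos p) < u (evenPos q) ∧ u (oddPos q) < u (oddPos p) then 1 else 0) +
  (if u (evenPos p) < u (oddPos q) ∧ u (evenPos q) < u (oddPos p) then 1 else 0) +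
  ((if u (oddPos p) < u (evenPos q) ∧ u (oddPos q) < u (evenPos p) then 1 else 0) +
  (if u (oddPos p) < u (oddPos q) ∧ u (evenPos q) < u (evenPos p) then 1 else 0))

theorem sum_sum_blocks {n : ℕ} (f : Fin (2 * n) → Fin (2 * n) → ℕ) :
    ∑ k, ∑ l, f k l = ∑ p, ∑ q, (f (evenPos p) (evenPos q) + f (evenPos p) (oddPos q) +
      (f (oddPos p) (evenPos q) + f (oddPos p) (oddPos q))) := by
  rw [sum_blocks]
  refine Finset.sum_congr rfl fun p _ => ?_
  rw [sum_blocks, sum_blocks, ← Finset.sum_add_distrib]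

theorem invCount_eq_sum_wordBlock {n : ℕ} (u : Perm (Fin (2 * n))) :
    invCount u = ∑ p, ∑ q, wordBlock u p q := by
  unfold invCount
  rw [sum_sum_blocks]
  rfl

theorem invCount_eq_sum_cycleBlock {n : ℕ} (u : Perm (Fin (2 * n))) :
    invCount (u * wFPF n * u⁻¹) = ∑ p, ∑ q, cycleBlock u p q := by
  unfold invCount
  rw [← sum_sum_comp_perm u, sum_sum_blocks]
  simp only [Perm.mul_apply, Perm.inv_def, symm_apply_apply, wFPF_evenPos, wFPF_oddPos]
  rfl

theorem two_mul_sum_sum {n : ℕ} (f : Fin n → Fin n → ℕ) :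
    2 * ∑ p, ∑ q, f p q = ∑ p, ∑ q, (f p q + f q p) := by
  simp only [Finset.sum_add_distrib]
  rw [Finset.sum_comm (f := fun p q => f q p), two_mul]

/-- The pairs in `u` are increasing, and two of them may appear with decreasing first letters
only if the cycles are nested. -/
def IsGood {n : ℕ} (u : Perm (Fin (2 * n))) : Prop :=
  (∀ p : Fin n, u (evenPos p) < u (oddPos p)) ∧
  ∀ p q : Fin n, p < q → u (evenPos q) < u (evenPos p) → u (oddPos p) < u (oddPos q)

theorem cycleBlock_diag {n : ℕ} (u : Perm (Fin (2 * n))) (p : Fin n) :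
    cycleBlock u p p = 1 ∧ (wordBlock u p p = 0 ↔ u (evenPos p) < u (oddPos p)) := by
  have hne : u (evenPos p) ≠ u (oddPos p) := fun h => evenPos_ne_oddPos p p (u.injective h)
  rcases lt_or_gt_of_ne hne with h | h <;>
    simp [cycleBlock, wordBlock, evenPos_lt_oddPos, oddPos_lt_evenPos, h, h.not_gt]

/-- The contributions of two blocks `a b` and `c d` depend only on the relative order of the four
letters. `N` counts inversions of the involution and `M` those of the word, with the first index in
the first block and the second in the other. For increasing blocks equality fails exactly when `c <
a` and `d < b`. -/
theorem four_letters_bound {m : ℕ} {a b c d : Fin m} (hab : a ≠ b) (hac : a ≠ c) (had : a ≠ d)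
    (hbc : b ≠ c) (hbd : b ≠ d) (hcd : c ≠ d) {N M : ℕ}
    (hN : N = (if a < c ∧ d < b then 1 else 0) + (if a < d ∧ c < b then 1 else 0) +
      ((if b < c ∧ d < a then 1 else 0) + (if b < d ∧ c < a then 1 else 0)))
    (hM : M = (if c < a then 1 else 0) + (if d < a then 1 else 0) +
      ((if c < b then 1 else 0) + (if d < b then 1 else 0))) :
    N ≤ M ∧ (a < b → c < d → (N = M ↔ (a ≤ c ∨ b < d))) := by
  rcases lt_or_gt_of_ne hab with h₁ | h₁ <;> rcases lt_or_gt_of_ne hac with h₂ | h₂ <;>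
  rcases lt_or_gt_of_ne had with h₃ | h₃ <;> rcases lt_or_gt_of_ne hbc with h₄ | h₄ <;>
  rcases lt_or_gt_of_ne hbd with h₅ | h₅ <;> rcases lt_or_gt_of_ne hcd with h₆ | h₆ <;>
  simp only [h₂, h₃, h₄, h₅, h₂.not_gt, h₃.not_gt, h₄.not_gt, h₅.not_gt, and_true,
    and_false, if_true, if_false] at hN hM <;>
  simp only [Fin.lt_def, Fin.le_def] at * <;>
  exact ⟨by omega, fun _ _ => by omega⟩

theorem block_bound {n : ℕ} (u : Perm (Fin (2 * n))) {p q : Fin n} (hpq : p < q) :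
    cycleBlock u p q + cycleBlock u q p ≤ 2 * (wordBlock u p q + wordBlock u q p) ∧
    (u (evenPos p) < u (oddPos p) → u (evenPos q) < u (oddPos q) →
      (cycleBlock u p q + cycleBlock u q p = 2 * (wordBlock u p q + wordBlock u q p) ↔
        (u (evenPos q) < u (evenPos p) → u (oddPos p) < u (oddPos q)))) := by
  have hne := hpq.ne
  have h := four_letters_bound (a := u (evenPos p)) (b := u (oddPos p)) (c := u (evenPos q))
    (d := u (oddPos q)) (u.injective.ne (evenPos_ne_oddPos _ _))
    (u.injective.ne (evenPos_injective.ne hne)) (u.injective.ne (evenPos_ne_oddPos _ _))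
    (u.injective.ne (evenPos_ne_oddPos _ _).symm) (u.injective.ne (oddPos_injective.ne hne))
    (u.injective.ne (evenPos_ne_oddPos _ _)) rfl rfl
  have e₁ : wordBlock u p q = (if u (evenPos q) < u (evenPos p) then 1 else 0) +
      (if u (oddPos q) < u (evenPos p) then 1 else 0) +
      ((if u (evenPos q) < u (oddPos p) then 1 else 0) +
      (if u (oddPos q) < u (oddPos p) then 1 else 0)) := by
    simp only [wordBlock, evenPos_lt_evenPos, evenPos_lt_oddPos, oddPos_lt_evenPos,
      oddPos_lt_oddPos, hpq, hpq.le, true_and]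
  have e₂ : wordBlock u q p = 0 := by
    simp [wordBlock, evenPos_lt_evenPos, evenPos_lt_oddPos, oddPos_lt_evenPos,
      oddPos_lt_oddPos, hpq.not_gt, hpq.not_ge]
  have e₃ : cycleBlock u q p = cycleBlock u p q := by
    simp only [cycleBlock, and_comm]
    omega
  rw [e₂, e₃, add_zero, e₁, ← two_mul]
  refine ⟨Nat.mul_le_mul_left 2 h.1, fun h₁ h₂ => ?_⟩
  rw [Nat.mul_right_inj two_ne_zero, imp_iff_not_or, not_lt]
  exact h.2 h₁ h₂

/-- Both sides are doubled and symmetrized in the two block indices, so that the estimates for pairs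
of blocks apply termwise. Equality of the sums then forces equality in every term. -/
theorem invCount_conj_eq_iff {n : ℕ} (u : Perm (Fin (2 * n))) :
    invCount (u * wFPF n * u⁻¹) = n + 2 * invCount u ↔ IsGood u := by
  -- Each cycle contributes one inversion of its own, counted twice after doubling; these diagonal
  -- terms account for the summand `n`.
  have hn : 2 * n = ∑ p : Fin n, ∑ q : Fin n, if p = q then 2 else 0 := by
    simp [mul_comm]
  have hx := two_mul_sum_sum (cycleBlock u)
  have hu := two_mul_sum_sum (wordBlock u)
  rw [← invCount_eq_sum_cycleBlock] at hx
  rw [← invCount_eq_sum_wordBlock] at hu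
  have hle : ∀ p q : Fin n, cycleBlock u p q + cycleBlock u q p ≤
      2 * (wordBlock u p q + wordBlock u q p) + if p = q then 2 else 0 := by
    intro p q
    rcases lt_trichotomy p q with h | rfl | h
    · rw [if_neg h.ne]
      exact (block_bound u h).1
    · rw [if_pos rfl, (cycleBlock_diag u p).1]
      omega
    · rw [if_neg h.ne', add_comm (cycleBlock u p q), add_comm (wordBlock u p q)]
      exact (block_bound u h).1
  have e : 2 * (n + 2 * invCount u) = ∑ p : Fin n, ∑ q : Fin n,
      (2 * (wordBlock u p q + wordBlock u q p) + if p = q then 2 else 0) := by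
    simp only [Finset.sum_add_distrib (g := fun q => if _ = q then 2 else 0), ← Finset.mul_sum]
    rw [Finset.sum_add_distrib, ← hn, ← Finset.mul_sum, ← hu]
    ring
  rw [← Nat.mul_right_inj two_ne_zero, hx, e,
    Finset.sum_eq_sum_iff_of_le fun p _ => Finset.sum_le_sum fun q _ => hle p q]
  simp only [Finset.sum_eq_sum_iff_of_le fun q _ => hle _ q, Finset.mem_univ, true_implies]
  constructor
  · intro h
    have h₁ : ∀ p, u (evenPos p) < u (oddPos p) := by
      intro p
      rw [← (cycleBlock_diag u p).2]
      have := h p p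
      rw [if_pos rfl, (cycleBlock_diag u p).1] at this
      omega
    refine ⟨h₁, fun p q hpq => ?_⟩
    have := h p q
    rw [if_neg hpq.ne, add_zero] at this
    exact ((block_bound u hpq).2 (h₁ p) (h₁ q)).1 this
  · rintro ⟨h₁, h₂⟩ p q
    rcases lt_trichotomy p q with h | rfl | h
    · rw [if_neg h.ne]
      exact ((block_bound u h).2 (h₁ p) (h₁ q)).2 (h₂ p q h)
    · rw [if_pos rfl, (cycleBlock_diag u p).1, (cycleBlock_diag u p).2.2 (h₁ p)]
    · rw [if_neg h.ne', add_comm (cycleBlock u p q), add_comm (wordBlock u p q)]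
      exact ((block_bound u h).2 (h₁ q) (h₁ p)).2 (h₂ q p h)

theorem invCount_wFPF (n : ℕ) : invCount (wFPF n) = n := by
  have h := (invCount_conj_eq_iff (1 : Perm (Fin (2 * n)))).2
    ⟨fun p => by simp [evenPos_lt_oddPos], fun p q h₁ h₂ => by
      simp only [Perm.coe_one, id_eq, evenPos_lt_evenPos] at h₂
      exact absurd h₂ h₁.not_gt⟩
  simpa [invCount_one] using h

theorem mem_fpfAtoms_iff {n : ℕ} {x u₀ : Perm (Fin (2 * n))} (h₀ : u₀ * wFPF n * u₀⁻¹ = x)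
    (hgood : IsGood u₀) (u : Perm (Fin (2 * n))) :
    u⁻¹ ∈ fpfAtoms x ↔ u * wFPF n * u⁻¹ = x ∧ IsGood u := by
  have hlen := (invCount_conj_eq_iff u₀).2 hgood
  rw [h₀] at hlen
  rw [fpfAtoms, mem_atoms_iff (wFPF_mem_fpfInvolutions n) (v := u₀⁻¹) (by simpa using h₀)
    (by rw [invCount_wFPF, invCount_inv, hlen]), _root_.inv_inv, invCount_wFPF, invCount_inv,
    ← invCount_conj_eq_iff]
  exact and_congr_right fun h => by rw [h]

/-! ### Weak order and inversion sets -/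

/-- `IsInv v i j`: the values `i < j` appear in decreasing order in the word `v`. -/
def IsInv {m : ℕ} (v : Perm (Fin m)) (i j : Fin m) : Prop :=
  i < j ∧ v⁻¹ j < v⁻¹ i

theorem isInv_mul_swap_iff {m : ℕ} {p q : Fin m} (hpq : (p : ℕ) + 1 = q) {v : Perm (Fin m)}
    (hv : v p < v q) {i j : Fin m} :
    IsInv (v * swap p q) i j ↔ IsInv v i j ∨ (i = v p ∧ j = v q) := by
  have hlt : p < q := by rw [Fin.lt_def]; omega
  by_cases hne : i = v p ∧ j = v q
  · obtain ⟨rfl, rfl⟩ := hne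
    simp [IsInv, hv, hlt]
  have hne' : ¬(i = v q ∧ j = v p) ∨ ¬ i < j := by
    by_contra! h
    obtain ⟨⟨rfl, rfl⟩, h⟩ := h
    exact h.not_gt hv
  rcases hne' with h' | h'
  · simp only [hne, or_false, IsInv]
    refine and_congr_right fun _ => ?_
    rw [mul_inv_rev, swap_inv, Perm.mul_apply, Perm.mul_apply]
    refine swap_lt_swap_iff hpq (fun e => h' ?_) fun e => hne ?_
    · rw [← e.1, ← e.2]; simp
    · rw [← e.1, ← e.2]; simp
  · simp [IsInv, h', hne]

theorem weakStep_iff {m : ℕ} {u v : Perm (Fin m)} :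
    WeakStep u v ↔ ∃ p q : Fin m, (p : ℕ) + 1 = q ∧ u p < u q ∧ v = u * swap p q := by
  constructor
  · rintro ⟨t, ⟨p, q, hpq, rfl⟩, rfl, h⟩
    exact ⟨p, q, hpq, (ell_lt_ell_mul_swap_iff hpq).1 h, rfl⟩
  · rintro ⟨p, q, hpq, h, rfl⟩
    exact ⟨_, swap_mem_simpleGens hpq, rfl, (ell_lt_ell_mul_swap_iff hpq).2 h⟩

theorem WeakStep.invCount {m : ℕ} {u v : Perm (Fin m)} (h : WeakStep u v) :
    invCount v = invCount u + 1 := by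
  obtain ⟨p, q, hpq, hlt, rfl⟩ := weakStep_iff.1 h
  exact invCount_mul_swap_of_lt hpq hlt

theorem WeakStep.isInv {m : ℕ} {u v : Perm (Fin m)} (h : WeakStep u v) {i j : Fin m}
    (hij : IsInv u i j) : IsInv v i j := by
  obtain ⟨p, q, hpq, hlt, rfl⟩ := weakStep_iff.1 h
  exact (isInv_mul_swap_iff hpq hlt).2 (Or.inl hij)

theorem invCount_le {m : ℕ} (w : Perm (Fin m)) : invCount w ≤ m * m := by
  calc invCount w ≤ ∑ _k : Fin m, ∑ _l : Fin m, 1 :=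
        Finset.sum_le_sum fun k _ => Finset.sum_le_sum fun l _ => by split_ifs <;> simp
    _ = m * m := by simp

/-- If `u ≠ v`, then `v⁻¹ * u` has a descent at adjacent positions. The two letters of `u` there are
inverted in `v` but not in `u`, so exchanging them is a step up that keeps the inversions inside
those of `v`. -/
theorem weak_of_isInv_imp {m : ℕ} {u v : Perm (Fin m)}
    (h : ∀ i j, IsInv u i j → IsInv v i j) : Relation.ReflTransGen WeakStep u v := by
  induction hk : m * m - invCount u generalizing u with
  | zero | succ k ih =>
    by_cases huv : StrictMono (v⁻¹ * u)
    · rw [inv_mul_eq_one.1 (perm_eq_one_of_strictMono huv)]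
    have : ∃ p q : Fin m, (p : ℕ) + 1 = q ∧ v⁻¹ (u q) < v⁻¹ (u p) := by
      by_contra! hcon
      exact huv <| strictMono_of_adjacent fun p q hpq =>
        (apply_lt_or_gt hpq (v⁻¹ * u)).resolve_right (hcon p q hpq).not_gt
    obtain ⟨p, q, hpq, hlt⟩ := this
    have hp : p < q := by rw [Fin.lt_def]; omega
    have hu : u p < u q := by
      refine (apply_lt_or_gt hpq u).resolve_right fun h' => ?_
      have := (h (u q) (u p) ⟨h', by simpa using hp⟩).2
      exact this.not_gt hlt
    have hstep : WeakStep u (u * swap p q) := weakStep_iff.2 ⟨p, q, hpq, hu, rfl⟩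
    have hcount := hstep.invCount
    have hbound := invCount_le (u * swap p q)
    -- When the induction counter is zero, the step up would exceed the bound `m * m`; otherwise the
    -- induction hypothesis applies after the step.
    first
    | omega
    | refine Relation.ReflTransGen.head hstep (ih (fun i j hij => ?_) (by omega))
      rcases (isInv_mul_swap_iff hpq hu).1 hij with h' | ⟨rfl, rfl⟩
      · exact h i j h'
      · exact ⟨hu, hlt⟩

/-- The right weak order is containment of inversion sets. -/
theorem rightWeak_le_iff {m : ℕ} {u v : RightWeak m} :
    u ≤ v ↔ ∀ i j, IsInv (u : Perm (Fin m)) i j → IsInv (v : Perm (Fin m)) i j := by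
  refine ⟨fun h => ?_, weak_of_isInv_imp⟩
  induction (show Relation.ReflTransGen WeakStep u v from h) with
  | refl => exact fun _ _ => id
  | tail h' hs ih => exact fun i j hij => hs.isInv (ih h' i j hij)

theorem rightWeak_id_le {m : ℕ} (v : RightWeak m) : RightWeak.id m ≤ v := by
  refine rightWeak_le_iff.2 fun i j h => ?_
  exact absurd h.2 (by simpa [RightWeak.id] using h.1.le)

/-- The relations that occur as inversion sets of permutations. -/
structure IsInvRel {m : ℕ} (T : Fin m → Fin m → Prop) : Prop where
  lt : ∀ {i j}, T i j → i < j
  trans : ∀ {i j k}, T i j → T j k → T i k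
  cotrans : ∀ {i j k}, i < j → j < k → T i k → T i j ∨ T j k

theorem isInvRel_isInv {m : ℕ} (v : Perm (Fin m)) : IsInvRel (IsInv v) where
  lt h := h.1
  trans h h' := ⟨h.1.trans h'.1, h'.2.trans h.2⟩
  cotrans {i j k} hij hjk h := by
    rcases lt_or_ge (v⁻¹ j) (v⁻¹ i) with h' | h'
    · exact Or.inl ⟨hij, h'⟩
    · exact Or.inr ⟨hjk, h.2.trans_le h'⟩

theorem IsInvRel.compl {m : ℕ} {T : Fin m → Fin m → Prop} (hT : IsInvRel T) :
    IsInvRel fun i j => i < j ∧ ¬ T i j where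
  lt h := h.1
  trans h h' := ⟨h.1.trans h'.1, fun h'' => (hT.cotrans h.1 h'.1 h'').elim h.2 h'.2⟩
  cotrans {i j k} hij hjk h := by
    by_cases h₁ : T i j
    · exact Or.inr ⟨hjk, fun h₂ => h.2 (hT.trans h₁ h₂)⟩
    · exact Or.inl ⟨hij, h₁⟩

theorem IsInvRel.exists_perm {m : ℕ} {T : Fin m → Fin m → Prop} (hT : IsInvRel T) :
    ∃ v : Perm (Fin m), ∀ i j, IsInv v i j ↔ T i j := by
  classical
  -- `B i j` prescribes that `i` stand before `j` in the word. It is a strict total order, so the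
  -- position of a letter is the number of its predecessors.
  let B : Fin m → Fin m → Prop := fun i j => (i < j ∧ ¬ T i j) ∨ T j i
  have hB : ∀ {i j}, B i j ∨ B j i ∨ i = j := by
    intro i j
    rcases lt_trichotomy i j with h | h | h
    · by_cases h' : T i j
      · exact Or.inr (Or.inl (Or.inr h'))
      · exact Or.inl (Or.inl ⟨h, h'⟩)
    · exact Or.inr (Or.inr h)
    · by_cases h' : T j i
      · exact Or.inl (Or.inr h')
      · exact Or.inr (Or.inl (Or.inl ⟨h, h'⟩))
  have hirr : ∀ {i}, ¬ B i i := fun h => h.elim (fun h => h.1.ne rfl) fun h => (hT.lt h).ne rfl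
  have htrans : ∀ {i j k}, B i j → B j k → B i k := by
    intro i j k h₁ h₂
    rcases h₁ with ⟨h₁, h₁'⟩ | h₁ <;> rcases h₂ with ⟨h₂, h₂'⟩ | h₂
    · exact Or.inl ⟨h₁.trans h₂, fun h => (hT.cotrans h₁ h₂ h).elim h₁' h₂'⟩
    · rcases lt_trichotomy i k with h | rfl | h
      · exact Or.inl ⟨h, fun h' => h₁' (hT.trans h' h₂)⟩
      · exact absurd h₂ h₁'
      · exact Or.inr ((hT.cotrans h h₁ h₂).resolve_right h₁')
    · rcases lt_trichotomy i k with h | rfl | h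
      · exact Or.inl ⟨h, fun h' => h₂' (hT.trans h₁ h')⟩
      · exact absurd h₁ h₂'
      · exact Or.inr ((hT.cotrans h₂ h h₁).resolve_left h₂')
    · exact Or.inr (hT.trans h₂ h₁)
  let below : Fin m → Finset (Fin m) := fun i => Finset.univ.filter fun j => B j i
  have hmono : ∀ {i j}, B i j → (below i).card < (below j).card := by
    intro i j h
    refine Finset.card_lt_card (Finset.ssubset_iff_of_subset ?_ |>.2 ⟨i, ?_, ?_⟩)
    · exact fun k hk => by
        simp only [below, Finset.mem_filter, Finset.mem_univ, true_and] at hk ⊢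
        exact htrans hk h
    · simpa [below] using h
    · simpa [below] using hirr
  have hlt : ∀ i, (below i).card < m := by
    intro i
    have : (below i).card < (Finset.univ : Finset (Fin m)).card :=
      Finset.card_lt_card (Finset.ssubset_iff_of_subset (Finset.subset_univ _) |>.2
        ⟨i, Finset.mem_univ _, by simpa [below] using hirr⟩)
    simpa using this
  let r : Fin m → Fin m := fun i => ⟨(below i).card, hlt i⟩
  have hr : ∀ {i j}, B i j → r i < r j := hmono
  have hinj : Function.Injective r := by
    intro i j h
    rcases hB (i := i) (j := j) with h' | h' | h'
    · exact absurd h (hr h').ne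
    · exact absurd h (hr h').ne'
    · exact h'
  let e : Perm (Fin m) := Equiv.ofBijective r (Finite.injective_iff_bijective.1 hinj)
  refine ⟨e⁻¹, fun i j => ?_⟩
  rw [IsInv, _root_.inv_inv]
  change i < j ∧ r j < r i ↔ T i j
  constructor
  · rintro ⟨h, h'⟩
    by_contra hcon
    exact (hr (Or.inl ⟨h, hcon⟩)).not_gt h'
  · exact fun h => ⟨hT.lt h, hr (Or.inr h)⟩

/-- The transitive closure of the union of two inversion sets is an inversion set. -/
theorem IsInvRel.transGen_or {m : ℕ} {A B : Fin m → Fin m → Prop} (hA : IsInvRel A)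
    (hB : IsInvRel B) : IsInvRel (Relation.TransGen fun i j => A i j ∨ B i j) where
  lt h := by
    induction h with
    | single h => exact h.elim hA.lt hB.lt
    | tail _ h ih => exact ih.trans (h.elim hA.lt hB.lt)
  trans h h' := h.trans h'
  cotrans {i j k} hij hjk h := by
    -- A chain from `i` to `k` either visits `j` or has a link jumping over `j`; cotransitivity of
    -- `A` or `B` splits that link at `j`.
    have hco : ∀ {x y}, A x y ∨ B x y → x < j → j < y →
        (A x j ∨ B x j) ∨ (A j y ∨ B j y) := by
      rintro x y (h | h) h₁ h₂
      · exact (hA.cotrans h₁ h₂ h).imp Or.inl Or.inl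
      · exact (hB.cotrans h₁ h₂ h).imp Or.inr Or.inr
    induction h with
    | single h => exact (hco h hij hjk).imp .single .single
    | @tail y z h hyz ih =>
      rcases lt_trichotomy j y with hy | rfl | hy
      · exact (ih hy).imp id fun h' => h'.tail hyz
      · exact Or.inl h
      · exact (hco hyz hy hjk).imp (fun h' => h.tail h') .single

theorem rightWeak_exists_isLUB {m : ℕ} (u v : RightWeak m) : ∃ j, IsLUB {u, v} j := by
  obtain ⟨w, hw⟩ := ((isInvRel_isInv (m := m) u).transGen_or (isInvRel_isInv v)).exists_perm
  refine ⟨w, ?_⟩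
  constructor
  · rintro z (rfl | rfl)
    · exact rightWeak_le_iff.2 fun i j h => (hw i j).2 (.single (Or.inl h))
    · exact rightWeak_le_iff.2 fun i j h => (hw i j).2 (.single (Or.inr h))
  · intro z hz
    have hu := rightWeak_le_iff.1 (hz (Set.mem_insert u _))
    have hv := rightWeak_le_iff.1 (hz (Set.mem_insert_of_mem u rfl))
    refine rightWeak_le_iff.2 fun i j h => ?_
    have h' := (hw i j).1 h
    clear h
    induction h' with
    | single h => exact h.elim (hu _ _) (hv _ _)
    | tail _ h₂ ih =>
      exact (isInvRel_isInv (m := m) z).trans ih (h₂.elim (hu _ _) (hv _ _))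

/-- Complementation within `<` preserves inversion sets and reverses containment, so the meet is the
complement of the join of the complements. -/
theorem rightWeak_exists_isGLB {m : ℕ} (u v : RightWeak m) : ∃ j, IsGLB {u, v} j := by
  have hT := (isInvRel_isInv (m := m) u).compl.transGen_or (isInvRel_isInv (m := m) v).compl
  obtain ⟨w, hw⟩ := hT.compl.exists_perm
  refine ⟨w, ?_⟩
  constructor
  · rintro z (rfl | rfl)
    · refine rightWeak_le_iff.2 fun i j h => ?_
      obtain ⟨h₁, h₂⟩ := (hw i j).1 h
      by_contra hcon
      exact h₂ (.single (Or.inl ⟨h₁, hcon⟩))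
    · refine rightWeak_le_iff.2 fun i j h => ?_
      obtain ⟨h₁, h₂⟩ := (hw i j).1 h
      by_contra hcon
      exact h₂ (.single (Or.inr ⟨h₁, hcon⟩))
  · intro z hz
    have hu := rightWeak_le_iff.1 (hz (Set.mem_insert u _))
    have hv := rightWeak_le_iff.1 (hz (Set.mem_insert_of_mem u rfl))
    refine rightWeak_le_iff.2 fun i j h => (hw i j).2 ⟨h.1, fun h' => ?_⟩
    have hstep : ∀ {i j}, (i < j ∧ ¬ IsInv (m := m) u i j) ∨ (i < j ∧ ¬ IsInv (m := m) v i j) →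
        i < j ∧ ¬ IsInv (m := m) z i j := by
      rintro i j (h | h)
      · exact ⟨h.1, fun h' => h.2 (hu _ _ h')⟩
      · exact ⟨h.1, fun h' => h.2 (hv _ _ h')⟩
    suffices i < j ∧ ¬ IsInv (m := m) z i j from this.2 h
    clear h
    induction h' with
    | single h => exact hstep h
    | tail _ h₂ ih => exact (isInvRel_isInv (m := m) z).compl.trans ih (hstep h₂)

theorem rightWeak_Icc_exists_isLUB {m : ℕ} {a b : RightWeak m} (u v : Set.Icc a b) :
    ∃ j, IsLUB {u, v} j := by
  obtain ⟨j, hj⟩ := rightWeak_exists_isLUB (u : RightWeak m) v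
  have h₁ := hj.1 (Set.mem_insert _ _)
  have h₂ := hj.1 (Set.mem_insert_of_mem _ rfl)
  have hb : j ≤ b := hj.2 (by rintro z (rfl | rfl); exacts [u.2.2, v.2.2])
  refine ⟨⟨j, u.2.1.trans h₁, hb⟩, ?_, fun z hz => ?_⟩
  · rintro z (rfl | rfl)
    exacts [h₁, h₂]
  · refine hj.2 (show z.1 ∈ _ from ?_)
    rintro y (rfl | rfl)
    exacts [hz (Set.mem_insert _ _), hz (Set.mem_insert_of_mem _ rfl)]

theorem rightWeak_Icc_exists_isGLB {m : ℕ} {a b : RightWeak m} (u v : Set.Icc a b) :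
    ∃ j, IsGLB {u, v} j := by
  obtain ⟨j, hj⟩ := rightWeak_exists_isGLB (u : RightWeak m) v
  have h₁ := hj.1 (Set.mem_insert _ _)
  have h₂ := hj.1 (Set.mem_insert_of_mem _ rfl)
  have hb : a ≤ j := hj.2 (by rintro z (rfl | rfl); exacts [u.2.1, v.2.1])
  refine ⟨⟨j, hb, h₁.trans u.2.2⟩, ?_, fun z hz => ?_⟩
  · rintro z (rfl | rfl)
    exacts [h₁, h₂]
  · refine hj.2 (show z.1 ∈ _ from ?_)
    rintro y (rfl | rfl)
    exacts [hz (Set.mem_insert _ _), hz (Set.mem_insert_of_mem _ rfl)]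

theorem invCount_strictMono {m : ℕ} {u v : RightWeak m} (h : u < v) :
    invCount (u : Perm (Fin m)) < invCount (v : Perm (Fin m)) := by
  have h₁ := ell_eq_invCount (m := m) u
  have h₂ := ell_eq_invCount (m := m) v
  have h₃ := (ell_le_of_weak (m := m) h.le).resolve_left h.ne
  omega

/-- The first step of a weak chain from `u` to `v` stays in the interval, so a covering leaves no
room for a second step. -/
theorem weakStep_of_covBy_Icc {m : ℕ} {a b : RightWeak m} {u v : Set.Icc a b} (h : u ⋖ v) :
    WeakStep (m := m) u.1 v.1 := by
  have key : ∀ z : RightWeak m, WeakStep (m := m) u.1 z → z ≤ v.1 → z = v.1 := by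
    intro z hz h₂
    have h₁ : u.1 ≤ z := .single hz
    have h₃ : u < (⟨z, u.2.1.trans h₁, h₂.trans v.2.2⟩ : Set.Icc a b) := by
      refine lt_of_le_of_ne h₁ fun h => ?_
      have e : u.1 = z := congrArg Subtype.val h
      have := hz.invCount
      rw [e] at this
      omega
    exact congrArg Subtype.val ((h.eq_or_eq h₃.le h₂).resolve_left h₃.ne')
  have hle : Relation.ReflTransGen (WeakStep (m := m)) u.1 v.1 := h.le
  rcases hle.cases_head with h' | ⟨z, hz, hzv⟩
  · exact absurd (Subtype.ext h') h.lt.ne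
  · have e : z = v.1 := key z hz hzv
    rwa [← e]

/-- The grading of an interval of the right weak order by Coxeter length. -/
@[reducible] def gradeOrderIcc {m : ℕ} (a b : RightWeak m) : GradeOrder ℕ (Set.Icc a b) where
  grade u := invCount (m := m) u.1
  grade_strictMono _ _ h := invCount_strictMono h
  covBy_grade _ _ h := by
    rw [(weakStep_of_covBy_Icc h).invCount, Nat.covBy_iff_add_one_eq]

/-! ### Words listing the cycles of an involution -/

/-- The permutation of the blocks of `Fin (2 * n)` induced by a permutation of `Fin n`. -/
noncomputable def blockPerm {n : ℕ} (v : Perm (Fin n)) : Perm (Fin (2 * n)) :=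
  (Equiv.ofBijective _ bijective_elim_evenPos_oddPos).permCongr (Equiv.sumCongr v v)

theorem blockPerm_evenPos {n : ℕ} (v : Perm (Fin n)) (p : Fin n) :
    blockPerm v (evenPos p) = evenPos (v p) := by
  have h : evenPos p = Equiv.ofBijective _ bijective_elim_evenPos_oddPos (Sum.inl p) := rfl
  rw [blockPerm, permCongr_apply, h, symm_apply_apply]
  rfl

theorem blockPerm_oddPos {n : ℕ} (v : Perm (Fin n)) (p : Fin n) :
    blockPerm v (oddPos p) = oddPos (v p) := by
  have h : oddPos p = Equiv.ofBijective _ bijective_elim_evenPos_oddPos (Sum.inr p) := rfl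
  rw [blockPerm, permCongr_apply, h, symm_apply_apply]
  rfl

theorem perm_ext_blocks {n : ℕ} {u v : Perm (Fin (2 * n))}
    (h₁ : ∀ p, u (evenPos p) = v (evenPos p)) (h₂ : ∀ p, u (oddPos p) = v (oddPos p)) :
    u = v := by
  refine Equiv.ext fun k => ?_
  obtain ⟨p, rfl | rfl⟩ := exists_evenPos_or_oddPos k
  exacts [h₁ p, h₂ p]

theorem blockPerm_injective {n : ℕ} : Function.Injective (blockPerm (n := n)) := by
  intro v v' h
  refine Equiv.ext fun p => evenPos_injective ?_
  rw [← blockPerm_evenPos, h, blockPerm_evenPos]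

theorem blockPerm_mul {n : ℕ} (v v' : Perm (Fin n)) :
    blockPerm (v * v') = blockPerm v * blockPerm v' :=
  perm_ext_blocks (fun p => by simp only [Perm.mul_apply, blockPerm_evenPos])
    fun p => by simp only [Perm.mul_apply, blockPerm_oddPos]

theorem blockPerm_mul_wFPF {n : ℕ} (v : Perm (Fin n)) :
    blockPerm v * wFPF n = wFPF n * blockPerm v :=
  perm_ext_blocks
    (fun p => by simp only [Perm.mul_apply, blockPerm_evenPos, blockPerm_oddPos, wFPF_evenPos])
    fun p => by simp only [Perm.mul_apply, blockPerm_evenPos, blockPerm_oddPos, wFPF_oddPos]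

theorem mul_blockPerm_conj {n : ℕ} (u : Perm (Fin (2 * n))) (v : Perm (Fin n)) :
    u * blockPerm v * wFPF n * (u * blockPerm v)⁻¹ = u * wFPF n * u⁻¹ := by
  rw [mul_assoc u, blockPerm_mul_wFPF]
  group

/-- The word `[a₁, b₁, …, aₙ, bₙ]` listing the cycles `aᵢ < bᵢ` of a fixed-point-free involution
with `a₁ < ⋯ < aₙ`. -/
theorem exists_sorted_word {n : ℕ} {x : Perm (Fin (2 * n))} (hx : x ∈ fpfInvolutions (2 * n)) :
    ∃ u : Perm (Fin (2 * n)), u * wFPF n * u⁻¹ = x ∧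
      (∀ p, u (evenPos p) < u (oddPos p)) ∧ StrictMono fun p => u (evenPos p) := by
  classical
  have hxx : ∀ i, x (x i) = i := fun i => by
    have h := hx.1
    rw [inv_eq_iff_mul_eq_one] at h
    rw [← Perm.mul_apply, h, Perm.one_apply]
  set A : Finset (Fin (2 * n)) := Finset.univ.filter fun i => i < x i with hA
  have hmem : ∀ i, i ∈ A ↔ i < x i := fun i => by simp [hA]
  -- The involution exchanges the smaller and the larger elements of its cycles, so there are `n` of
  -- each.
  have hcompl : A.card = Aᶜ.card := by
    refine Finset.card_equiv x fun i => ?_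
    rw [Finset.mem_compl, hmem, hmem, hxx, not_lt]
    exact ⟨le_of_lt, fun h => lt_of_le_of_ne h (hx.2 i).symm⟩
  have hcard : A.card = n := by
    have := A.card_add_card_compl
    rw [Fintype.card_fin] at this
    omega
  have ha : ∀ p, A.orderEmbOfFin hcard p < x (A.orderEmbOfFin hcard p) := fun p =>
    (hmem _).1 (A.orderEmbOfFin_mem hcard p)
  have hbij : Function.Bijective
      (Sum.elim (A.orderEmbOfFin hcard) fun p => x (A.orderEmbOfFin hcard p)) := by
    refine (Fintype.bijective_iff_injective_and_card _).2 ⟨?_, by simp [two_mul]⟩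
    refine (A.orderEmbOfFin hcard).injective.sumElim
      (x.injective.comp (A.orderEmbOfFin hcard).injective) fun p q h => ?_
    have h₁ := ha p
    rw [h, hxx] at h₁
    exact h₁.not_gt (ha q)
  let e := Equiv.ofBijective _ (bijective_elim_evenPos_oddPos (n := n))
  let u : Perm (Fin (2 * n)) := e.symm.trans (Equiv.ofBijective _ hbij)
  have hu₁ : ∀ p, u (evenPos p) = A.orderEmbOfFin hcard p := fun p => by
    change Equiv.ofBijective _ hbij (e.symm (e (Sum.inl p))) = _
    rw [symm_apply_apply]
    rfl
  have hu₂ : ∀ p, u (oddPos p) = x (A.orderEmbOfFin hcard p) := fun p => by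
    change Equiv.ofBijective _ hbij (e.symm (e (Sum.inr p))) = _
    rw [symm_apply_apply]
    rfl
  refine ⟨u, ?_, fun p => ?_, fun p q h => ?_⟩
  · rw [mul_inv_eq_iff_eq_mul]
    refine perm_ext_blocks (fun p => ?_) fun p => ?_
    · rw [Perm.mul_apply, Perm.mul_apply, wFPF_evenPos, hu₁, hu₂]
    · rw [Perm.mul_apply, Perm.mul_apply, wFPF_oddPos, hu₁, hu₂, hxx]
  · rw [hu₁, hu₂]
    exact ha p
  · simpa only [hu₁] using (A.orderEmbOfFin hcard).strictMono h

/-- Both words list the cycles of the same involution, each with its smaller element first, so they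
differ only in the order of the cycles. -/
theorem IsGood.exists_eq_mul_blockPerm {n : ℕ} {u u₀ : Perm (Fin (2 * n))} (hu : IsGood u)
    (h₀ : ∀ p, u₀ (evenPos p) < u₀ (oddPos p))
    (h : u * wFPF n * u⁻¹ = u₀ * wFPF n * u₀⁻¹) : ∃ v, u = u₀ * blockPerm v := by
  have h' : u * wFPF n = u₀ * wFPF n * u₀⁻¹ * u := by rw [← h]; group
  have hodd : ∀ p, u (oddPos p) = u₀ (wFPF n (u₀⁻¹ (u (evenPos p)))) := fun p => by
    have := congrArg (fun e : Perm (Fin (2 * n)) => e (evenPos p)) h'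
    simpa only [Perm.mul_apply, wFPF_evenPos] using this
  have hex : ∀ p, ∃ q, u (evenPos p) = u₀ (evenPos q) := by
    intro p
    obtain ⟨q, hq | hq⟩ := exists_evenPos_or_oddPos (u₀⁻¹ (u (evenPos p)))
    · exact ⟨q, Perm.inv_eq_iff_eq.1 hq⟩
    · have h₁ := hu.1 p
      rw [hodd p, hq, wFPF_oddPos, Perm.inv_eq_iff_eq.1 hq] at h₁
      exact absurd h₁ (h₀ q).not_gt
  choose v hv using hex
  have hinj : Function.Injective v := by
    intro p q hpq
    refine evenPos_injective (u.injective ?_)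
    rw [hv, hv, hpq]
  refine ⟨Equiv.ofBijective v (Finite.injective_iff_bijective.1 hinj),
    perm_ext_blocks (fun p => ?_) fun p => ?_⟩
  · rw [Perm.mul_apply, blockPerm_evenPos, hv]
    rfl
  · rw [hodd, hv, Perm.inv_eq_iff_eq.2 rfl, wFPF_evenPos, Perm.mul_apply, blockPerm_oddPos]
    rfl

/-- Because the first letters of `u₀` increase, two blocks of the rearranged word have decreasing
first letters exactly at an inversion of `v`. -/
theorem isGood_mul_blockPerm_iff {n : ℕ} {u₀ : Perm (Fin (2 * n))}
    (h₀ : ∀ p, u₀ (evenPos p) < u₀ (oddPos p)) (hmono : StrictMono fun p => u₀ (evenPos p))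
    (v : Perm (Fin n)) :
    IsGood (u₀ * blockPerm v) ↔ ∀ i j, IsInv v i j → u₀ (oddPos j) < u₀ (oddPos i) := by
  simp only [IsGood, Perm.mul_apply, blockPerm_evenPos, blockPerm_oddPos, h₀, implies_true,
    true_and]
  constructor
  · rintro h i j ⟨hij, hv⟩
    have := h _ _ hv
    simp only [Perm.inv_def, apply_symm_apply] at this
    exact this (hmono hij)
  · intro h p q hpq hlt
    exact h _ _ ⟨hmono.lt_iff_lt.1 hlt, by simpa using hpq⟩

/-! ### The moves of `≺` as exchanges of adjacent blocks -/

theorem oneLine_eq_map_range {m : ℕ} (u : Perm (Fin m)) :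
    oneLine u = (List.range m).map fun k => if h : k < m then ((u ⟨k, h⟩ : ℕ) : ℤ) + 1 else 0 := by
  refine List.ext_getElem (by simp [oneLine]) fun k h₁ h₂ => ?_
  have hk : k < m := by simpa [oneLine] using h₁
  simp [oneLine, hk]

theorem range_split_block {n p : ℕ} (h : p + 1 < n) : List.range (2 * n) =
    List.range (2 * p) ++ [2 * p, 2 * p + 1, 2 * p + 2, 2 * p + 3] ++
      (List.range (2 * (n - p - 2))).map (2 * p + 4 + ·) := by
  have e : 2 * n = 2 * p + 4 + 2 * (n - p - 2) := by omega
  rw [e, List.range_add, List.range_add]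
  simp [List.range_succ]

/-- The effect on one-line notation of exchanging two adjacent blocks. -/
theorem exists_oneLine_mul_blockPerm_swap {n : ℕ} {p q : Fin n} (hpq : (p : ℕ) + 1 = q)
    (u : Perm (Fin (2 * n))) : ∃ α β : List ℤ, α.length = 2 * p ∧ Even β.length ∧
      oneLine u = α ++ [(u (evenPos p) : ℤ) + 1, (u (oddPos p) : ℤ) + 1,
        (u (evenPos q) : ℤ) + 1, (u (oddPos q) : ℤ) + 1] ++ β ∧
      oneLine (u * blockPerm (swap p q)) = α ++ [(u (evenPos q) : ℤ) + 1,
        (u (oddPos q) : ℤ) + 1, (u (evenPos p) : ℤ) + 1, (u (oddPos p) : ℤ) + 1] ++ β := by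
  let g : Perm (Fin (2 * n)) → ℕ → ℤ := fun u k =>
    if h : k < 2 * n then ((u ⟨k, h⟩ : ℕ) : ℤ) + 1 else 0
  have hone : ∀ u : Perm (Fin (2 * n)), oneLine u = (List.range (2 * n)).map (g u) :=
    oneLine_eq_map_range
  have hq := q.isLt
  have hev : ∀ (u : Perm (Fin (2 * n))) (r : Fin n) (k : ℕ), k = 2 * r →
      g u k = (u (evenPos r) : ℤ) + 1 := by
    rintro u r k rfl
    exact dif_pos (by omega)
  have hod : ∀ (u : Perm (Fin (2 * n))) (r : Fin n) (k : ℕ), k = 2 * r + 1 →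
      g u k = (u (oddPos r) : ℤ) + 1 := by
    rintro u r k rfl
    exact dif_pos (by omega)
  have hoff : ∀ k : ℕ, k < 2 * p ∨ 2 * p + 4 ≤ k →
      g (u * blockPerm (swap p q)) k = g u k := by
    intro k hk
    by_cases h : k < 2 * n
    · have h₁ : (⟨k / 2, by omega⟩ : Fin n) ≠ p := by
        rw [Ne, Fin.ext_iff]; simp only; omega
      have h₂ : (⟨k / 2, by omega⟩ : Fin n) ≠ q := by
        rw [Ne, Fin.ext_iff]; simp only; omega
      rcases Nat.mod_two_eq_zero_or_one k with hm | hm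
      · rw [hev _ ⟨k / 2, by omega⟩ k (by simp only; omega),
          hev _ ⟨k / 2, by omega⟩ k (by simp only; omega), Perm.mul_apply, blockPerm_evenPos,
          swap_apply_of_ne_of_ne h₁ h₂]
      · rw [hod _ ⟨k / 2, by omega⟩ k (by simp only; omega),
          hod _ ⟨k / 2, by omega⟩ k (by simp only; omega), Perm.mul_apply, blockPerm_oddPos,
          swap_apply_of_ne_of_ne h₁ h₂]
    · simp only [g, h, dif_neg, not_false_eq_true]
  refine ⟨(List.range (2 * p)).map (g u),
    ((List.range (2 * (n - p - 2))).map fun k => 2 * (p : ℕ) + 4 + k).map (g u), by simp, by simp, ?_, ?_⟩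
  · rw [hone, range_split_block (p := p) (n := n) (by omega), List.map_append, List.map_append]
    simp only [List.map_cons, List.map_nil]
    rw [hev u p _ rfl, hod u p _ rfl, hev u q _ (by omega), hod u q _ (by omega)]
  · rw [hone, range_split_block (p := p) (n := n) (by omega), List.map_append, List.map_append]
    simp only [List.map_cons, List.map_nil]
    rw [hev _ p _ rfl, hod _ p _ rfl, hev _ q _ (by omega), hod _ q _ (by omega)]
    simp only [Perm.mul_apply, blockPerm_evenPos, blockPerm_oddPos, swap_apply_left,
      swap_apply_right]
    congr 1
    · congr 1
      exact List.map_congr_left fun k hk => hoff k (Or.inl (List.mem_range.1 hk))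
    · refine List.map_congr_left fun k hk => hoff k (Or.inr ?_)
      obtain ⟨r, -, rfl⟩ := List.mem_map.1 hk
      omega

theorem precStep_mul_blockPerm_swap {n : ℕ} {p q : Fin n} (hpq : (p : ℕ) + 1 = q)
    {u : Perm (Fin (2 * n))} (h₁ : u (evenPos p) < u (evenPos q))
    (h₂ : u (evenPos q) < u (oddPos q)) (h₃ : u (oddPos q) < u (oddPos p)) :
    PrecStep (oneLine u) (oneLine (u * blockPerm (swap p q))) := by
  obtain ⟨α, β, hα, hβ, e₁, e₂⟩ := exists_oneLine_mul_blockPerm_swap hpq u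
  rw [e₁, e₂]
  rw [Fin.lt_def] at h₁ h₂ h₃
  exact PrecStep.mk α β _ _ _ _ (by simp [hα]) hβ (by omega) (by omega) (by omega)

/-- The even length of `α` makes the move start at a block boundary, and distinctness of the letters
makes the weak inequalities strict. -/
theorem PrecStep.exists_eq_mul_blockPerm_swap {n : ℕ} {u : Perm (Fin (2 * n))} {L : List ℤ}
    (h : PrecStep (oneLine u) L) : ∃ p q : Fin n, (p : ℕ) + 1 = q ∧
      u (evenPos p) < u (evenPos q) ∧ u (oddPos q) < u (oddPos p) ∧
      L = oneLine (u * blockPerm (swap p q)) := by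
  generalize hM : oneLine u = M at h
  cases h with
  | mk α β a b c d hα hβ hab hbc hcd =>
    have hlen := congrArg List.length hM
    simp only [oneLine, List.length_ofFn, List.length_append, List.length_cons,
      List.length_nil] at hlen
    obtain ⟨r, hr⟩ := hα
    obtain ⟨t, ht⟩ := hβ
    let p : Fin n := ⟨r, by omega⟩
    let q : Fin n := ⟨r + 1, by omega⟩
    have hpq : (p : ℕ) + 1 = q := rfl
    have hne : p ≠ q := fun h => by
      have := congrArg Fin.val h
      omega
    obtain ⟨α', β', hα', -, e₁, e₂⟩ := exists_oneLine_mul_blockPerm_swap hpq u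
    have hαα : α.length = α'.length := by
      rw [hα', hr]
      exact (two_mul r).symm
    rw [hM, List.append_assoc, List.append_assoc] at e₁
    obtain ⟨e₄, e₃⟩ := List.append_inj e₁ hαα
    simp only [List.cons_append, List.nil_append, List.cons.injEq] at e₃
    obtain ⟨ea, ed, eb, ec, eβ⟩ := e₃
    have h₁ : u (evenPos p) ≠ u (evenPos q) := u.injective.ne (evenPos_injective.ne hne)
    have h₂ : u (oddPos p) ≠ u (oddPos q) := u.injective.ne (oddPos_injective.ne hne)
    refine ⟨p, q, hpq, lt_of_le_of_ne ?_ h₁, lt_of_le_of_ne ?_ h₂.symm, ?_⟩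
    · rw [Fin.le_def]; omega
    · rw [Fin.le_def]; omega
    · rw [e₂, e₄, eβ, ea, eb, ec, ed]

/-- With `b` the larger elements of the sorted cycles, this yields the top element `w` of the
interval. -/
theorem isInvRel_and_lt {n : ℕ} {α : Type*} [LinearOrder α] (b : Fin n → α) :
    IsInvRel fun i j => i < j ∧ b j < b i where
  lt h := h.1
  trans h h' := ⟨h.1.trans h'.1, h'.2.trans h.2⟩
  cotrans {i j k} hij hjk h := by
    rcases lt_or_ge (b j) (b i) with h' | h'
    · exact Or.inl ⟨hij, h'⟩
    · exact Or.inr ⟨hjk, h.2.trans_le h'⟩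

/-! ### The isomorphism with a weak order interval -/

section Isomorphism

variable {n : ℕ} {u₀ : Perm (Fin (2 * n))} {w : Perm (Fin n)}

theorem weak_iff {m : ℕ} {u v : Perm (Fin m)} :
    Relation.ReflTransGen WeakStep u v ↔ ∀ i j, IsInv u i j → IsInv v i j :=
  rightWeak_le_iff (m := m)

/-- The inversion created by the step persists in `w`, so the two exchanged blocks are nested, as a
move of `≺` requires. -/
theorem precStep_of_weakStep (h₀ : ∀ p, u₀ (evenPos p) < u₀ (oddPos p))
    (hmono : StrictMono fun p => u₀ (evenPos p))
    (hw : ∀ i j, IsInv w i j ↔ i < j ∧ u₀ (oddPos j) < u₀ (oddPos i))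
    {v v' : Perm (Fin n)} (h : WeakStep v v') (hv' : Relation.ReflTransGen WeakStep v' w) :
    PrecStep (oneLine (u₀ * blockPerm v)) (oneLine (u₀ * blockPerm v')) := by
  obtain ⟨p, q, hpq, hlt, rfl⟩ := weakStep_iff.1 h
  have hinv : IsInv (v * swap p q) (v p) (v q) :=
    (isInv_mul_swap_iff hpq hlt).2 (Or.inr ⟨rfl, rfl⟩)
  have hb := ((hw _ _).1 (weak_iff.1 hv' _ _ hinv)).2
  rw [blockPerm_mul, ← mul_assoc]
  refine precStep_mul_blockPerm_swap hpq ?_ ?_ ?_ <;>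
    simp only [Perm.mul_apply, blockPerm_evenPos, blockPerm_oddPos]
  exacts [hmono hlt, h₀ _, hb]

theorem exists_weakStep_of_precStep (hmono : StrictMono fun p => u₀ (evenPos p))
    (hw : ∀ i j, IsInv w i j ↔ i < j ∧ u₀ (oddPos j) < u₀ (oddPos i))
    {v : Perm (Fin n)} (hv : Relation.ReflTransGen WeakStep v w) {L : List ℤ}
    (h : PrecStep (oneLine (u₀ * blockPerm v)) L) :
    ∃ v', WeakStep v v' ∧ Relation.ReflTransGen WeakStep v' w ∧
      L = oneLine (u₀ * blockPerm v') := by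
  obtain ⟨p, q, hpq, h₁, h₂, rfl⟩ := h.exists_eq_mul_blockPerm_swap
  simp only [Perm.mul_apply, blockPerm_evenPos, blockPerm_oddPos] at h₁ h₂
  have hlt := hmono.lt_iff_lt.1 h₁
  refine ⟨v * swap p q, weakStep_iff.2 ⟨p, q, hpq, hlt, rfl⟩, ?_, ?_⟩
  · refine weak_iff.2 fun i j hij => ?_
    rcases (isInv_mul_swap_iff hpq hlt).1 hij with h' | ⟨rfl, rfl⟩
    · exact weak_iff.1 hv i j h'
    · exact (hw _ _).2 ⟨hlt, h₂⟩
  · rw [mul_assoc, ← blockPerm_mul]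

theorem eq_or_prec_iff_weak (h₀ : ∀ p, u₀ (evenPos p) < u₀ (oddPos p))
    (hmono : StrictMono fun p => u₀ (evenPos p))
    (hw : ∀ i j, IsInv w i j ↔ i < j ∧ u₀ (oddPos j) < u₀ (oddPos i))
    {v v' : Perm (Fin n)} (hv : Relation.ReflTransGen WeakStep v w)
    (hv' : Relation.ReflTransGen WeakStep v' w) :
    (u₀ * blockPerm v = u₀ * blockPerm v' ∨
      Prec (oneLine (u₀ * blockPerm v)) (oneLine (u₀ * blockPerm v'))) ↔
    Relation.ReflTransGen WeakStep v v' := by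
  have hinj : ∀ {v v' : Perm (Fin n)}, u₀ * blockPerm v = u₀ * blockPerm v' → v = v' :=
    fun h => blockPerm_injective (mul_left_cancel h)
  constructor
  · rintro (h | h)
    · rw [hinj h]
    -- The intermediate terms of a `≺`-chain are a priori arbitrary integer lists; inductively each
    -- is the word of some `z` below `w`.
    · have key : ∀ L, Prec (oneLine (u₀ * blockPerm v)) L →
          ∃ z, Relation.ReflTransGen WeakStep v z ∧ Relation.ReflTransGen WeakStep z w ∧
            L = oneLine (u₀ * blockPerm z) := by
        intro L hL
        induction hL with
        | single h =>
          obtain ⟨z, hz, hzw, e⟩ := exists_weakStep_of_precStep hmono hw hv h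
          exact ⟨z, .single hz, hzw, e⟩
        | tail _ h ih =>
          obtain ⟨y, hvy, hyw, rfl⟩ := ih
          obtain ⟨z, hz, hzw, e⟩ := exists_weakStep_of_precStep hmono hw hyw h
          exact ⟨z, hvy.tail hz, hzw, e⟩
      obtain ⟨z, hvz, -, e⟩ := key _ h
      rwa [hinj (oneLine_injective e)]
  · intro h
    induction h with
    | refl => exact Or.inl rfl
    | @tail y z hvy hyz ih =>
      have hstep := precStep_of_weakStep h₀ hmono hw hyz hv'
      rcases ih (hv'.head hyz) with e | h'
      · rw [e]
        exact Or.inr (.single hstep)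
      · exact Or.inr (h'.tail hstep)

theorem isGood_mul_blockPerm_iff_weak (h₀ : ∀ p, u₀ (evenPos p) < u₀ (oddPos p))
    (hmono : StrictMono fun p => u₀ (evenPos p))
    (hw : ∀ i j, IsInv w i j ↔ i < j ∧ u₀ (oddPos j) < u₀ (oddPos i)) (v : Perm (Fin n)) :
    IsGood (u₀ * blockPerm v) ↔ Relation.ReflTransGen WeakStep v w := by
  rw [isGood_mul_blockPerm_iff h₀ hmono, weak_iff]
  exact forall₂_congr fun i j => ⟨fun h h' => (hw i j).2 ⟨h'.1, h h'⟩,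
    fun h h' => ((hw i j).1 (h h')).2⟩

end Isomorphism

theorem exists_orderIso_Icc {n : ℕ} {x : Perm (Fin (2 * n))} (hx : x ∈ fpfInvolutions (2 * n)) :
    ∃ w : RightWeak n, Nonempty (FPFAtomsInv x ≃o Set.Icc (RightWeak.id n) w) := by
  obtain ⟨u₀, hu₀, h₀, hmono⟩ := exists_sorted_word hx
  obtain ⟨w, hw⟩ := (isInvRel_and_lt fun p => u₀ (oddPos p)).exists_perm
  -- Sorted first letters make the nesting condition vacuous, so `u₀` supplies the witness of
  -- maximal gain needed to describe the atoms.
  have hgood₀ : IsGood u₀ := ⟨h₀, fun p q hpq h => absurd h (hmono hpq).not_gt⟩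
  have hgood := isGood_mul_blockPerm_iff_weak h₀ hmono hw
  have hmem := mem_fpfAtoms_iff hu₀ hgood₀
  have hmem' : ∀ v : Perm (Fin n), Relation.ReflTransGen WeakStep v w →
      (u₀ * blockPerm v)⁻¹ ∈ fpfAtoms x := fun v hv =>
    (hmem _).2 ⟨by rw [mul_blockPerm_conj, hu₀], (hgood v).2 hv⟩
  let w' : RightWeak n := w
  let f : Set.Icc (RightWeak.id n) w' → FPFAtomsInv x := fun v =>
    ⟨u₀ * blockPerm v.1, hmem' v.1 v.2.2⟩
  have hf : Function.Bijective f := by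
    constructor
    · intro v v' h
      exact Subtype.ext (blockPerm_injective (mul_left_cancel (congrArg Subtype.val h)))
    · rintro ⟨u, hu⟩
      obtain ⟨h₁, h₂⟩ := (hmem u).1 hu
      obtain ⟨v, rfl⟩ := h₂.exists_eq_mul_blockPerm h₀ (h₁.trans hu₀.symm)
      exact ⟨⟨v, rightWeak_id_le _, (hgood v).1 h₂⟩, rfl⟩
  let e : Set.Icc (RightWeak.id n) w' ≃o FPFAtomsInv x :=
    { Equiv.ofBijective f hf with
      map_rel_iff' := fun {v v'} => by
        refine Iff.trans ?_ (eq_or_prec_iff_weak h₀ hmono hw v.2.2 v'.2.2)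
        exact or_congr Subtype.ext_iff Iff.rfl }
  exact ⟨w', ⟨e.symm⟩⟩

end FPFAtoms

theorem proposition6p23 (n : ℕ) (x : Equiv.Perm (Fin (2 * n)))
    (hx : x ∈ FPFAtoms.fpfInvolutions (2 * n)) :
    (∃ w : FPFAtoms.RightWeak n,
      Nonempty (FPFAtoms.FPFAtomsInv x ≃o Set.Icc (FPFAtoms.RightWeak.id n) w)) ∧
    (∀ u v : FPFAtoms.FPFAtomsInv x,
      (∃ j, IsLUB {u, v} j) ∧ (∃ k, IsGLB {u, v} k)) ∧
    Nonempty (GradeOrder ℕ (FPFAtoms.FPFAtomsInv x)) := by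
  obtain ⟨w, ⟨e⟩⟩ := FPFAtoms.exists_orderIso_Icc hx
  refine ⟨⟨w, ⟨e⟩⟩, fun u v => ⟨?_, ?_⟩, ⟨?_⟩⟩
  · obtain ⟨j, hj⟩ := FPFAtoms.rightWeak_Icc_exists_isLUB (e u) (e v)
    refine ⟨e.symm j, ?_⟩
    rwa [← e.isLUB_image', Set.image_pair, e.apply_symm_apply]
  · obtain ⟨j, hj⟩ := FPFAtoms.rightWeak_Icc_exists_isGLB (e u) (e v)
    refine ⟨e.symm j, ?_⟩
    rwa [← e.isGLB_image', Set.image_pair, e.apply_symm_apply]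
  · exact
      { grade := fun u => (FPFAtoms.gradeOrderIcc _ w).grade (e u)
        grade_strictMono := fun _ _ h =>
          (FPFAtoms.gradeOrderIcc _ w).grade_strictMono (e.strictMono h)
        covBy_grade := fun _ _ h =>
          (FPFAtoms.gradeOrderIcc _ w).covBy_grade ((apply_covBy_apply_iff e).2 h) }
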